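/- Let $a,b,m,n$ be positive integers with $am-bn\in\{-1,1\}$. Let $g$ be a holomorphic function on a neighborhood of $0\in\mathbb{C}$ and let $f$ be a function meromorphic at $0\in\mathbb{C}$, with Laurent series $f(z)=\sum_{k}f_kz^k$ around $0$, such that the map $(x,y)\mapsto x^ay^bf(x^ny^m)$ is (i.e. extends to) a holomorphic function of order at least $1$ at the origin of $\mathbb{C}^2$. Consider the germs at $(0,0)\in\mathbb{C}^2$ of holomorphic vector fields $$X=x^ay^b\left[mx\frac{\partial}{\partial x}-ny\frac{\partial}{\partial y}\right],$$ $$Y=g(x^ny^m)\left[x\left(-bm+x^ay^bf(x^ny^m)\right)\frac{\partial}{\partial x}+y\left(am-\frac{n}{m}x^ay^bf(x^ny^m)\right)\frac{\partial}{\partial y}\right].$$ Assume that one of the following conditions holds: 1. $g(0)\neq 0$; 2. $g(0)=g''(0)=f_0=0$ and $g'(0)\neq 0$. Then the Lie algebra generated by $X$ and $Y$ is univalent on every sufficiently small neighborhood of the origin: there is an open neighborhood $U_0$ of $(0,0)$ such that, for every connected open neighborhood $U\subseteq U_0$ of $(0,0)$, $X$ and $Y$ are holomorphic on $U$ and the complex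 Lie algebra of holomorphic vector fields on $U$ generated by $X$ and $Y$ is univalent. Here a complex Lie algebra $\mathfrak{g}$ of holomorphic vector fields on a complex manifold $M$ is called *univalent* if there are a finite-dimensional complex Lie group $G$ (group law written additively, with identity $0$) and a maximal local action $\Phi$ of $G$ on $M$ such that differentiating $\Phi(\cdot,p)$ at $0$ for each $p \in M$ identifies $T_0G$ isomorphically with $\mathfrak{g}$. A *local action* of $G$ on $M$ is a holomorphic map $\Phi:\Omega\to M$, where $\Omega\subseteq G\times M$ is open, connected and contains $\{0\}\times M$, such that $\Phi(0,p)=p$ for all $p\in M$, and $\Phi(g_1+g_2,p)=\Phi(g_1,\Phi(g_2,p))$ whenever both sides are defined. It is *maximal* if, for every $p\in M$ and every sequence $(g_i)$ in $V_p=\{g\in G : (g,p)\in\Omega\}$ converging to a point of the boundary of $V_p$ in $G$, the sequence $\Phi(g_i,p)$ leaves every compact subset of $M$. -/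

import Mathlib

open scoped Manifold ContDiff Topology

noncomputable section

namespace UnivalentPair

section VectorFields

variable {E : Type*} [NormedAddCommGroup E] [NormedSpace ℂ E]

/-- The holomorphic vector fields on the open set `U` of the complex vector space `E`. A vector field
on `U` is represented by its extension by zero to `E`, so that two of them are equal if and only if
they agree on `U`. -/
def holVectorFields (U : TopologicalSpace.Opens E) : Submodule ℂ (E → E) where
  carrier := {V | AnalyticOnNhd ℂ V (U : Set E) ∧ ∀ x, x ∉ U → V x = 0}
  zero_mem' := ⟨fun _ _ => analyticAt_const, fun _ _ => rfl⟩
  add_mem' := fun {V W} hV hW =>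
    ⟨hV.1.add hW.1, fun x hx => by simp [hV.2 x hx, hW.2 x hx]⟩
  smul_mem' := fun c V hV =>
    ⟨fun x hx => analyticAt_const.smul (hV.1 x hx), fun x hx => by simp [hV.2 x hx]⟩

variable {U : TopologicalSpace.Opens E}

theorem vf_ext {V W : holVectorFields U} (h : ∀ x ∈ U, (V : E → E) x = (W : E → E) x) : V = W := by
  apply Subtype.ext
  funext x
  by_cases hx : x ∈ U
  · exact h x hx
  · rw [V.2.2 x hx, W.2.2 x hx]

theorem differentiableAt_vf (V : holVectorFields U) {x : E} (hx : x ∈ U) :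
    DifferentiableAt ℂ (V : E → E) x := (V.2.1 x hx).differentiableAt

variable [FiniteDimensional ℂ E]

theorem lieBracket_mem {V W : E → E} (hV : V ∈ holVectorFields U) (hW : W ∈ holVectorFields U) :
    VectorField.lieBracket ℂ V W ∈ holVectorFields U := by
  have := FiniteDimensional.complete ℂ E
  refine ⟨fun x hx => ?_, fun x hx => ?_⟩
  · have h : ContDiffAt ℂ ω (VectorField.lieBracket ℂ V W) x :=
      ContDiffAt.lieBracket_vectorField (hV.1 x hx).contDiffAt (hW.1 x hx).contDiffAt le_top
    exact h.analyticAt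
  · exact VectorField.lieBracket_eq_zero_of_eq_zero (hV.2 x hx) (hW.2 x hx)

/-- The Lie bracket of vector fields, `[V, W](x) = DW(x) V(x) - DV(x) W(x)`. -/
instance : Bracket (holVectorFields U) (holVectorFields U) where
  bracket V W := ⟨VectorField.lieBracket ℂ V W, lieBracket_mem V.2 W.2⟩

theorem coe_bracket (V W : holVectorFields U) :
    ((⁅V, W⁆ : holVectorFields U) : E → E) = VectorField.lieBracket ℂ V W := rfl

instance : LieRing (holVectorFields U) where
  add_lie V₁ V₂ W := vf_ext fun _ hx =>
    VectorField.lieBracket_add_left (differentiableAt_vf V₁ hx) (differentiableAt_vf V₂ hx)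
  lie_add V W₁ W₂ := vf_ext fun _ hx =>
    VectorField.lieBracket_add_right (differentiableAt_vf W₁ hx) (differentiableAt_vf W₂ hx)
  lie_self V := Subtype.ext VectorField.lieBracket_self
  leibniz_lie V₁ V₂ V₃ := vf_ext fun x hx => by
    have := FiniteDimensional.complete ℂ E
    exact VectorField.leibniz_identity_lieBracket (n := ω) le_top
      (V₁.2.1 x hx).contDiffAt (V₂.2.1 x hx).contDiffAt (V₃.2.1 x hx).contDiffAt

instance : LieAlgebra ℂ (holVectorFields U) where
  lie_smul _ _ W := vf_ext fun _ hx =>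
    VectorField.lieBracket_const_smul_right (differentiableAt_vf W hx)

end VectorFields

section LocalActions

variable {E : Type*} [NormedAddCommGroup E] [NormedSpace ℂ E]
  {EG : Type*} [NormedAddCommGroup EG] [NormedSpace ℂ EG]
  {G : Type*} [AddGroup G] [TopologicalSpace G] [ChartedSpace EG G]

/-- `Φ : Ω → U` is a local action of the complex Lie group `G` on the open set `U ⊆ E`. The group law
is written additively, but `G` need not be commutative. Values of `Φ` outside `Ω` play no role. -/
structure IsLocalAction (U : Set E) (Ω : Set (G × E)) (Φ : G × E → E) : Prop where
  subset : Ω ⊆ Set.univ ×ˢ U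
  isOpen : IsOpen Ω
  isConnected : IsConnected Ω
  zero_mem : ∀ p ∈ U, ((0 : G), p) ∈ Ω
  mapsTo : Set.MapsTo Φ Ω U
  holomorphic : ContMDiffOn (𝓘(ℂ, EG).prod 𝓘(ℂ, E)) 𝓘(ℂ, E) ω Φ Ω
  map_zero : ∀ p ∈ U, Φ (0, p) = p
  map_add : ∀ (g₁ g₂ : G) (p : E), (g₂, p) ∈ Ω → (g₁, Φ (g₂, p)) ∈ Ω → (g₁ + g₂, p) ∈ Ω →
    Φ (g₁ + g₂, p) = Φ (g₁, Φ (g₂, p))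

/-- The set `V_p = {g | (g, p) ∈ Ω}`. -/
def timeDomain (Ω : Set (G × E)) (p : E) : Set G := {g | (g, p) ∈ Ω}

/-- Maximality of a local action: if `g_i ∈ V_p` converges to a boundary point of `V_p`, then
`Φ (g_i, p)` leaves every compact subset of `U`. -/
def IsMaximalLocalAction (U : Set E) (Ω : Set (G × E)) (Φ : G × E → E) : Prop :=
  IsLocalAction (EG := EG) U Ω Φ ∧
  ∀ p ∈ U, ∀ (γ : ℕ → G) (g : G), (∀ i, γ i ∈ timeDomain Ω p) →
    Filter.Tendsto γ Filter.atTop (𝓝 g) → g ∈ frontier (timeDomain Ω p) →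
    ∀ K : Set E, K ⊆ U → IsCompact K → ∀ᶠ i in Filter.atTop, Φ (γ i, p) ∉ K

/-- The Lie algebra `𝔤` of holomorphic vector fields on `U` is obtained by differentiating `Φ` at the
identity: `v ↦ (p ↦ d/dτ Φ (γ_v τ, p) at τ = 0)`, where `γ_v` is a curve with `γ_v(0) = 0` and
`γ_v'(0) = v`, is a linear isomorphism of the tangent space `T₀G` onto `𝔤`. -/
def IntegratesTo [FiniteDimensional ℂ E] {U : TopologicalSpace.Opens E}
    (𝔤 : LieSubalgebra ℂ (holVectorFields U)) (Φ : G × E → E) : Prop :=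
  ∃ ρ : TangentSpace 𝓘(ℂ, EG) (0 : G) ≃ₗ[ℂ] 𝔤,
    ∀ (v : TangentSpace 𝓘(ℂ, EG) (0 : G)), ∀ p ∈ U,
      mfderiv 𝓘(ℂ, EG) 𝓘(ℂ, E) (fun g : G => Φ (g, p)) 0 v = ((ρ v : holVectorFields U) : E → E) p

end LocalActions

/-- A Lie algebra of holomorphic vector fields on `U` is univalent if it can be integrated to a
maximal local action on `U` of some finite-dimensional complex Lie group `G`. -/
def IsUnivalent {E : Type*} [NormedAddCommGroup E] [NormedSpace ℂ E] [FiniteDimensional ℂ E]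
    {U : TopologicalSpace.Opens E} (𝔤 : LieSubalgebra ℂ (holVectorFields U)) : Prop :=
  ∃ (d : ℕ) (G : Type) (_ : AddGroup G) (_ : TopologicalSpace G)
    (_ : ChartedSpace (EuclideanSpace ℂ (Fin d)) G)
    (_ : LieAddGroup 𝓘(ℂ, EuclideanSpace ℂ (Fin d)) ω G) (_ : T2Space G)
    (_ : SecondCountableTopology G)
    (Ω : Set (G × E)) (Φ : G × E → E),
    IsMaximalLocalAction (EG := EuclideanSpace ℂ (Fin d)) (U : Set E) Ω Φ ∧
    IntegratesTo (EG := EuclideanSpace ℂ (Fin d)) 𝔤 Φ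

/-- `f` is meromorphic at `0`, with Laurent series `∑ c_k z^k`. -/
def HasLaurentSeriesAtZero (f : ℂ → ℂ) (c : ℤ → ℂ) : Prop :=
  (∃ N : ℤ, ∀ k < N, c k = 0) ∧ ∀ᶠ z in 𝓝[≠] (0 : ℂ), HasSum (fun k : ℤ => c k * z ^ k) (f z)

end UnivalentPair

end

/-! Put u = x^a y^b, w = x^n y^m and e = am - bn = ±1. Off the axes (u, w) are coordinates, since
the exponent matrix is unimodular. There X u = e u², X w = 0, Y w = e m w g(w) and Y(1/u) = -(e/m)
g(w) f(w).

Let N be the pole order of f at 0 (N = 0 if f is regular). A change of coordinates 1/u' = 1/u - e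
η(w)/w^N, w' = w κ(w) keeps the form of X. The functions η and κ are chosen so that Y becomes c X +
m l e W, with constants c and l ≠ 0, where W u' = 0 and W w' = w'^(j+1)
(`hasDerivAt_straighten_transverse`). Finding κ means normalizing z g(z) ∂z: it is linearizable if
g(0) ≠ 0 (j = 0), and conjugate to a multiple of z² ∂z under condition 2 (j = 1), where g''(0) = 0
says that the residue vanishes. Finding η means solving z η' - N η = K, whose only obstruction is
the coefficient of z^N in K; the constant c absorbs it in the first case, and f_0 = 0 removes it in
the second (`exists_normalizing_functions`). Holomorphy of F makes u/w^N a genuine monomial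
vanishing at 0, so the change of coordinates is a biholomorphism near 0.

The commuting fields eX and W of the normal form have an explicit flow: u is divided by 1 - v₀ u and
w by 1 - v₁ w^j. For j = 0 the parameter v₁ = 1 - exp(-t) replaces the time t, so the group is ℂ ×
ℂˣ; for j = 1 it is ℂ². Exactly one group element moves a given point off the axes to another.
Hence, over any connected open V, the pairs (g, p) with p and g·p in V form a connected set: its
part off the axes is parametrized by pairs of points. Maximality follows by passing to the limit in
the formulas for u and w (`isMaximalLocalAction_model`). The action is then pulled back to U
(`isUnivalent_of_normal_form`). -/

namespace UnivalentPair

open Set Filter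

/-! ### Density of the complement of the axes and connectedness of its trace on connected open sets.
-/

section OffAxes

/-- The complement of the coordinate axes of `ℂ²`. -/
def offAxes : Set (ℂ × ℂ) := {0}ᶜ ×ˢ {0}ᶜ

theorem dense_offAxes : Dense offAxes :=
  (dense_compl_singleton (0 : ℂ)).prod (dense_compl_singleton (0 : ℂ))

theorem eventuallyEq_of_offAxes {f₁ f₂ : ℂ × ℂ → ℂ} {p₀ : ℂ × ℂ}
    (h₁ : ∀ᶠ p in 𝓝 p₀, ContinuousAt f₁ p) (h₂ : ∀ᶠ p in 𝓝 p₀, ContinuousAt f₂ p)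
    (h : ∀ᶠ p in 𝓝 p₀, p.1 ≠ 0 → p.2 ≠ 0 → f₁ p = f₂ p) : f₁ =ᶠ[𝓝 p₀] f₂ := by
  filter_upwards [h₁, h₂, h.eventually_nhds] with p c₁ c₂ hp
  have hne : (𝓝[offAxes] p).NeBot := mem_closure_iff_nhdsWithin_neBot.mp (dense_offAxes p)
  refine tendsto_nhds_unique (f := f₁) (l := 𝓝[offAxes] p) (c₁.mono_left inf_le_left) ?_
  refine (c₂.mono_left inf_le_left).congr' ?_
  filter_upwards [nhdsWithin_le_nhds hp, self_mem_nhdsWithin] with q hq hq'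
  exact (hq hq'.1 hq'.2).symm

theorem isPreconnected_ball_diff_zero (r : ℝ) :
    IsPreconnected (Metric.ball (0 : ℂ) r \ {0}) := by
  -- A punctured disc is the exponential of a half-plane. The clause `0 < r` is needed because
  -- `Real.log` takes junk values for `r ≤ 0`.
  have h : Metric.ball (0 : ℂ) r \ {0} = Complex.exp '' {z | z.re < Real.log r ∧ 0 < r} := by
    ext z
    simp only [Set.mem_sdiff, mem_ball_zero_iff, mem_singleton_iff, mem_image, mem_ofPred_eq]
    constructor
    · rintro ⟨hz, hz0⟩
      refine ⟨Complex.log z, ⟨?_, (norm_nonneg z).trans_lt hz⟩, Complex.exp_log hz0⟩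
      rw [Complex.log_re]
      exact Real.log_lt_log (norm_pos_iff.mpr hz0) hz
    · rintro ⟨z, ⟨hz, hr⟩, rfl⟩
      refine ⟨?_, Complex.exp_ne_zero z⟩
      rw [Complex.norm_exp, ← Real.lt_log_iff_exp_lt hr]
      exact hz
  rw [h]
  refine IsPreconnected.image ?_ _ Complex.continuous_exp.continuousOn
  by_cases hr : 0 < r
  · simp only [hr, and_true]
    exact (convex_halfSpace_re_lt _).isPreconnected
  · simp only [hr, and_false, ofPred_false]
    exact isPreconnected_empty

theorem eventually_isPreconnected_ball_diff_zero (z : ℂ) :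
    ∀ᶠ r in 𝓝[>] (0 : ℝ), IsPreconnected (Metric.ball z r \ {0}) := by
  rcases eq_or_ne z 0 with rfl | hz
  · exact Eventually.of_forall isPreconnected_ball_diff_zero
  · filter_upwards [Ioo_mem_nhdsGT (norm_pos_iff.mpr hz)] with r hr
    rw [sdiff_singleton_eq_self]
    · exact (convex_ball z r).isPreconnected
    · simpa [dist_eq_norm] using hr.2.le

theorem exists_preconnected_inter_offAxes {U : Set (ℂ × ℂ)} (hU : IsOpen U) {p : ℂ × ℂ}
    (hp : p ∈ U) : ∃ N ⊆ U, IsOpen N ∧ p ∈ N ∧ IsPreconnected (N ∩ offAxes) := by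
  obtain ⟨R, hR, hRU⟩ := Metric.isOpen_iff.mp hU p hp
  obtain ⟨r, ⟨h₁, h₂⟩, hr⟩ := (((eventually_isPreconnected_ball_diff_zero p.1).and
    (eventually_isPreconnected_ball_diff_zero p.2)).and (Ioo_mem_nhdsGT hR)).exists
  refine ⟨Metric.ball p r, (Metric.ball_subset_ball hr.2.le).trans hRU, Metric.isOpen_ball,
    Metric.mem_ball_self hr.1, ?_⟩
  -- Balls for the sup norm are products of discs, so removing the axes leaves a product of
  -- punctured discs.
  have h : Metric.ball p r ∩ offAxes =
      (Metric.ball p.1 r \ {0}) ×ˢ (Metric.ball p.2 r \ {0}) := by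
    rw [← ball_prod_same, offAxes, prod_inter_prod, sdiff_eq, sdiff_eq]
  rw [h]
  exact h₁.prod h₂

/-- A dense subset that is locally preconnected in a connected open set `U` is preconnected in
`U`. -/
theorem IsPreconnected.inter_of_dense {α : Type*} [TopologicalSpace α] {U A : Set α}
    (hUo : IsOpen U) (hU : IsPreconnected U) (hA : Dense A)
    (hloc : ∀ p ∈ U, ∃ N ⊆ U, IsOpen N ∧ p ∈ N ∧ IsPreconnected (N ∩ A)) :
    IsPreconnected (U ∩ A) := by
  intro S T hS hT hsub hneS hneT
  by_contra hemp
  -- A separation of `U ∩ A` is enlarged to open sets `S'`, `T'`: the points near which `A` lies in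
  -- `S`, resp. `T`. Local preconnectedness makes them cover `U`, so they meet, and density of `A`
  -- then yields a point of `A` in both `S` and `T`.
  let S' : Set α := ⋃₀ {N | IsOpen N ∧ N ⊆ U ∧ N ∩ A ⊆ S}
  let T' : Set α := ⋃₀ {N | IsOpen N ∧ N ⊆ U ∧ N ∩ A ⊆ T}
  have hS' : IsOpen S' := isOpen_sUnion fun N hN => hN.1
  have hT' : IsOpen T' := isOpen_sUnion fun N hN => hN.1
  have hcov : U ⊆ S' ∪ T' := by
    intro p hp
    obtain ⟨N, hNU, hNo, hpN, hN⟩ := hloc p hp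
    by_cases h : (N ∩ A ∩ S).Nonempty
    · left
      refine ⟨N, ⟨hNo, hNU, ?_⟩, hpN⟩
      intro q hq
      by_contra hqS
      have hqT : q ∈ T := (hsub ⟨hNU hq.1, hq.2⟩).resolve_left hqS
      obtain ⟨z, hz, hz'⟩ := hN S T hS hT (fun z hz => hsub ⟨hNU hz.1, hz.2⟩) h ⟨q, hq, hqT⟩
      exact hemp ⟨z, ⟨hNU hz.1, hz.2⟩, hz'⟩
    · right
      refine ⟨N, ⟨hNo, hNU, ?_⟩, hpN⟩
      intro q hq
      exact (hsub ⟨hNU hq.1, hq.2⟩).resolve_left fun hqS => h ⟨q, hq, hqS⟩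
  have key : ∀ {S₁ : Set α}, IsOpen S₁ → (U ∩ A ∩ S₁).Nonempty →
      (U ∩ ⋃₀ {N | IsOpen N ∧ N ⊆ U ∧ N ∩ A ⊆ S₁}).Nonempty := by
    rintro S₁ hS₁ ⟨q, ⟨hqU, -⟩, hqS⟩
    exact ⟨q, hqU, U ∩ S₁, ⟨hUo.inter hS₁, inter_subset_left, fun z hz => hz.1.2⟩, hqU, hqS⟩
  obtain ⟨p, hpU, ⟨N₁, ⟨hN₁, -, hNS⟩, hp₁⟩, ⟨N₂, ⟨hN₂, -, hNT⟩, hp₂⟩⟩ :=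
    hU S' T' hS' hT' hcov (key hS hneS) (key hT hneT)
  obtain ⟨q, ⟨⟨hqU, hq₁⟩, hq₂⟩, hqA⟩ :=
    hA.inter_open_nonempty (U ∩ N₁ ∩ N₂) ((hUo.inter hN₁).inter hN₂) ⟨p, ⟨hpU, hp₁⟩, hp₂⟩
  exact hemp ⟨q, ⟨hqU, hqA⟩, hNS ⟨hq₁, hqA⟩, hNT ⟨hq₂, hqA⟩⟩

theorem isConnected_inter_offAxes {U : Set (ℂ × ℂ)} (hUo : IsOpen U) (hU : IsConnected U) :
    IsConnected (U ∩ offAxes) :=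
  ⟨dense_offAxes.inter_open_nonempty U hUo hU.nonempty,
    IsPreconnected.inter_of_dense hUo hU.isPreconnected dense_offAxes
      fun _ hp => exists_preconnected_inter_offAxes hUo hp⟩

end OffAxes

/-! ### Transport of maximal local actions. -/

section Transport

variable {E : Type*} [NormedAddCommGroup E] [NormedSpace ℂ E]
  {EG : Type*} [NormedAddCommGroup EG] [NormedSpace ℂ EG]
  {G : Type*} [AddGroup G] [TopologicalSpace G] [ChartedSpace EG G]

/-- Maximal local actions can be transported along biholomorphisms. -/
theorem IsMaximalLocalAction.transport (θ : OpenPartialHomeomorph E E) {U : Set E}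
    (hUo : IsOpen U) (hU : U ⊆ θ.source) (hθ : ContDiffOn ℂ ω θ U)
    (hθ' : ContDiffOn ℂ ω θ.symm (θ '' U)) {Ω : Set (G × E)} {Φ : G × E → E}
    (h : IsMaximalLocalAction (EG := EG) (θ '' U) Ω Φ) :
    IsMaximalLocalAction (EG := EG) U {x | x.2 ∈ U ∧ (x.1, θ x.2) ∈ Ω}
      (fun x => θ.symm (Φ (x.1, θ x.2))) := by
  obtain ⟨hΦ, hmax⟩ := h
  have hsymm : MapsTo θ.symm (θ '' U) U := by
    rintro _ ⟨p, hp, rfl⟩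
    rwa [θ.left_inv (hU hp)]
  have hright : ∀ q ∈ θ '' U, θ (θ.symm q) = q := by
    rintro _ ⟨p, hp, rfl⟩
    rw [θ.left_inv (hU hp)]
  have hopen : IsOpen {x : G × E | x.2 ∈ U ∧ (x.1, θ x.2) ∈ Ω} := by
    have hc : ContinuousOn (fun x : G × E => (x.1, θ x.2)) (univ ×ˢ U) :=
      continuousOn_fst.prodMk ((hθ.continuousOn).comp continuousOn_snd fun x hx => hx.2)
    have := hc.isOpen_inter_preimage (isOpen_univ.prod hUo) hΦ.isOpen
    convert this using 1
    ext x
    simp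
  refine ⟨⟨fun x hx => ⟨mem_univ _, hx.1⟩, hopen, ?_, ?_, ?_, ?_, ?_, ?_⟩, ?_⟩
  -- The new domain is the image of `Ω` under the inverse change of coordinates, hence connected.
  · have him : {x : G × E | x.2 ∈ U ∧ (x.1, θ x.2) ∈ Ω} =
        (fun x : G × E => (x.1, θ.symm x.2)) '' Ω := by
      ext ⟨g, p⟩
      simp only [mem_ofPred_eq, mem_image, Prod.mk.injEq, Prod.exists]
      constructor
      · rintro ⟨hp, hx⟩
        exact ⟨g, θ p, hx, rfl, θ.left_inv (hU hp)⟩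
      · rintro ⟨g, q, hx, rfl, rfl⟩
        have hq := (hΦ.subset hx).2
        exact ⟨hsymm hq, by rwa [hright q hq]⟩
    rw [him]
    refine hΦ.isConnected.image _ ?_
    exact continuousOn_fst.prodMk
      (hθ'.continuousOn.comp continuousOn_snd fun x hx => (hΦ.subset hx).2)
  · exact fun p hp => ⟨hp, hΦ.zero_mem _ (mem_image_of_mem θ hp)⟩
  · exact fun x hx => hsymm (hΦ.mapsTo hx.2)
  · have h₁ : ContMDiffOn (𝓘(ℂ, EG).prod 𝓘(ℂ, E)) (𝓘(ℂ, EG).prod 𝓘(ℂ, E)) ω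
        (fun x : G × E => (x.1, θ x.2)) {x | x.2 ∈ U ∧ (x.1, θ x.2) ∈ Ω} :=
      contMDiffOn_fst.prodMk (hθ.contMDiffOn.comp contMDiffOn_snd fun x hx => hx.1)
    exact hθ'.contMDiffOn.comp (hΦ.holomorphic.comp h₁ fun x hx => hx.2)
      fun x hx => hΦ.mapsTo hx.2
  · intro p hp
    simp only
    rw [hΦ.map_zero _ (mem_image_of_mem θ hp), θ.left_inv (hU hp)]
  · rintro g₁ g₂ p ⟨hp, h₂⟩ ⟨-, h₁⟩ ⟨-, h₁₂⟩
    simp only at h₁ h₂ h₁₂ ⊢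
    rw [hright _ (hΦ.mapsTo h₂)] at h₁ ⊢
    rw [hΦ.map_add _ _ _ h₂ h₁ h₁₂]
  · intro p hp γ g hγ hlim hg K hKU hK
    have hV : timeDomain {x : G × E | x.2 ∈ U ∧ (x.1, θ x.2) ∈ Ω} p = timeDomain Ω (θ p) := by
      ext g
      simp [timeDomain, hp]
    rw [hV] at hg
    have hγ' : ∀ i, γ i ∈ timeDomain Ω (θ p) := fun i => (hγ i).2
    filter_upwards [hmax (θ p) (mem_image_of_mem θ hp) γ g hγ' hlim hg (θ '' K) (image_mono hKU)
      (hK.image_of_continuousOn (hθ.continuousOn.mono hKU))] with i hi hiK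
    exact hi ⟨_, hiK, hright _ (hΦ.mapsTo (hγ' i))⟩

end Transport

/-! ### The group of times. -/

section TimeGroup

/-- The complex Lie group with underlying manifold `{v ∈ ℂ² | 1 - d v₁ ≠ 0}` and group law
`v + v' = (v₀ + v₀', v₁ + v₁' - d v₁ v₁')`: it is `ℂ²` if `d = 0`, and `ℂ × ℂˣ` if `d ≠ 0`. -/
def TimeGroup (d : ℂ) : Type := {v : EuclideanSpace ℂ (Fin 2) // 1 - d * v 1 ≠ 0}

variable {d : ℂ}

namespace TimeGroup

noncomputable instance : TopologicalSpace (TimeGroup d) := instTopologicalSpaceSubtype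

instance : T2Space (TimeGroup d) := inferInstanceAs (T2Space (Subtype _))

instance : SecondCountableTopology (TimeGroup d) :=
  inferInstanceAs (SecondCountableTopology (Subtype _))

/-- The inclusion of the group into `ℂ²`. -/
noncomputable def val (g : TimeGroup d) : EuclideanSpace ℂ (Fin 2) := Subtype.val g

theorem val_ne (g : TimeGroup d) : 1 - d * g.val 1 ≠ 0 := g.2

theorem val_injective : Function.Injective (val (d := d)) := Subtype.val_injective

theorem ext_val {g h : TimeGroup d} (h₀ : g.val 0 = h.val 0) (h₁ : g.val 1 = h.val 1) :
    g = h := by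
  apply val_injective
  ext i
  fin_cases i
  · exact h₀
  · exact h₁

/-- The law is made so that `1 - d v₁` is multiplicative, which also shows that the group is closed
under it. -/
noncomputable instance : Add (TimeGroup d) where
  add g h := ⟨!₂[g.val 0 + h.val 0, g.val 1 + h.val 1 - d * (g.val 1 * h.val 1)], by
    have := mul_ne_zero g.val_ne h.val_ne
    simp only [Matrix.cons_val_one, Matrix.cons_val_fin_one]
    convert this using 1
    ring⟩

noncomputable instance : Zero (TimeGroup d) where
  zero := ⟨0, by simp⟩

noncomputable instance : Neg (TimeGroup d) where
  neg g := ⟨!₂[-g.val 0, -g.val 1 / (1 - d * g.val 1)], by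
    have := g.val_ne
    simp only [Matrix.cons_val_one, Matrix.cons_val_fin_one]
    have h : 1 - d * (-g.val 1 / (1 - d * g.val 1)) = (1 - d * g.val 1)⁻¹ := by
      field_simp
      ring
    rw [h]
    exact inv_ne_zero this⟩

@[simp] theorem val_zero : (0 : TimeGroup d).val = 0 := rfl

@[simp] theorem val_add_zero (g h : TimeGroup d) : (g + h).val 0 = g.val 0 + h.val 0 := rfl

@[simp] theorem val_add_one (g h : TimeGroup d) :
    (g + h).val 1 = g.val 1 + h.val 1 - d * (g.val 1 * h.val 1) := rfl

@[simp] theorem val_neg_zero (g : TimeGroup d) : (-g).val 0 = -g.val 0 := rfl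

@[simp] theorem val_neg_one (g : TimeGroup d) :
    (-g).val 1 = -g.val 1 / (1 - d * g.val 1) := rfl

noncomputable instance : AddGroup (TimeGroup d) :=
  AddGroup.ofLeftAxioms
    (fun g h k => ext_val (by simp only [val_add_zero]; ring) (by simp only [val_add_one]; ring))
    (fun g => ext_val (by simp) (by simp))
    (fun g => ext_val (by simp) (by
      have h := div_mul_cancel₀ (-g.val 1) g.val_ne
      simp only [val_add_one, val_neg_one, val_zero, PiLp.zero_apply]
      linear_combination h))

theorem isOpenEmbedding_val : Topology.IsOpenEmbedding (val (d := d)) := by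
  apply IsOpen.isOpenEmbedding_subtypeVal
  exact isOpen_ne_fun (by fun_prop) (by fun_prop)

theorem range_val : range (val (d := d)) = {v | 1 - d * v 1 ≠ 0} := Subtype.range_val

noncomputable instance : ChartedSpace (EuclideanSpace ℂ (Fin 2)) (TimeGroup d) :=
  isOpenEmbedding_val.singletonChartedSpace

theorem contMDiff_val :
    ContMDiff 𝓘(ℂ, EuclideanSpace ℂ (Fin 2)) 𝓘(ℂ, EuclideanSpace ℂ (Fin 2)) ω (val (d := d)) :=
  contMDiff_isOpenEmbedding isOpenEmbedding_val

theorem contDiffOn_neg_coord : ContDiffOn ℂ ω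
    (fun v : EuclideanSpace ℂ (Fin 2) => !₂[-v 0, -v 1 / (1 - d * v 1)]) (range (val (d := d))) := by
  rw [contDiffOn_euclidean]
  intro i
  fin_cases i
  · simp only [Fin.zero_eta, Matrix.cons_val_zero]
    fun_prop
  · simp only [Fin.mk_one, Matrix.cons_val_one, Matrix.cons_val_fin_one]
    refine ContDiffOn.div (by fun_prop) (by fun_prop) ?_
    rw [range_val]
    exact fun _ h => h

instance : LieAddGroup 𝓘(ℂ, EuclideanSpace ℂ (Fin 2)) ω (TimeGroup d) where
  toIsManifold := isOpenEmbedding_val.isManifold_singleton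
  contMDiff_add := by
    apply ContMDiff.of_comp_isOpenEmbedding isOpenEmbedding_val
    have h : ContDiff ℂ ω (fun v : EuclideanSpace ℂ (Fin 2) × EuclideanSpace ℂ (Fin 2) =>
        !₂[v.1 0 + v.2 0, v.1 1 + v.2 1 - d * (v.1 1 * v.2 1)]) := by
      rw [contDiff_euclidean]
      intro i
      fin_cases i
      · simp only [Fin.zero_eta, Matrix.cons_val_zero]
        fun_prop
      · simp only [Fin.mk_one, Matrix.cons_val_one, Matrix.cons_val_fin_one]
        fun_prop
    exact h.contMDiff.comp ((contMDiff_val.comp contMDiff_fst).prodMk_space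
      (contMDiff_val.comp contMDiff_snd))
  contMDiff_neg := by
    apply ContMDiff.of_comp_isOpenEmbedding isOpenEmbedding_val
    exact contDiffOn_neg_coord.contMDiffOn.comp_contMDiff contMDiff_val fun g => mem_range_self g

theorem hasMFDerivAt_comp_val {E : Type*} [NormedAddCommGroup E] [NormedSpace ℂ E]
    {f : EuclideanSpace ℂ (Fin 2) → E} {f' : EuclideanSpace ℂ (Fin 2) →L[ℂ] E} {g : TimeGroup d}
    (hf : HasFDerivAt f f' g.val) :
    HasMFDerivAt 𝓘(ℂ, EuclideanSpace ℂ (Fin 2)) 𝓘(ℂ, E) (fun g : TimeGroup d => f g.val) g f' := by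
  refine ⟨ContinuousAt.comp hf.continuousAt isOpenEmbedding_val.continuous.continuousAt, ?_⟩
  have hev : ∀ᶠ v in 𝓝 g.val, v ∈ range (val (d := d)) :=
    isOpenEmbedding_val.isOpen_range.mem_nhds (mem_range_self g)
  have : HasFDerivAt
      (fun v => f ((isOpenEmbedding_val (d := d)).toOpenPartialHomeomorph.symm v).val) f' g.val := by
    refine hf.congr_of_eventuallyEq ?_
    filter_upwards [hev] with v hv
    rw [isOpenEmbedding_val.toOpenPartialHomeomorph_right_inv _ hv]
  exact this.hasFDerivWithinAt

end TimeGroup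

end TimeGroup

/-! ### Diagonal maps acting on the two monomials. -/

section Scaling

/-- The monomial `x ^ i * y ^ k`. -/
def mono (i k : ℕ) (p : ℂ × ℂ) : ℂ := p.1 ^ i * p.2 ^ k

/-- The diagonal linear map which, if `e = a * m - b * n` is a sign, divides `x ^ a * y ^ b` by `α`
and `x ^ n * y ^ m` by `β`. -/
noncomputable def scale (a b m n : ℕ) (e : ℤ) (α β : ℂ) (p : ℂ × ℂ) : ℂ × ℂ :=
  (p.1 * (α ^ (-(e * m)) * β ^ (e * b)), p.2 * (α ^ (e * n) * β ^ (-(e * a))))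

variable {a b m n : ℕ} {e : ℤ} {α β α' β' : ℂ}

theorem mono_ne_zero {p : ℂ × ℂ} (hp : p ∈ offAxes) (i k : ℕ) : mono i k p ≠ 0 :=
  mul_ne_zero (pow_ne_zero _ hp.1) (pow_ne_zero _ hp.2)

theorem mono_scale (hα : α ≠ 0) (hβ : β ≠ 0) (i k : ℕ) (p : ℂ × ℂ) :
    mono i k (scale a b m n e α β p) =
      mono i k p * (α ^ (e * (n * k - m * i)) * β ^ (e * (b * i - a * k))) := by
  have h₁ : α ^ (e * (n * k - m * i)) = (α ^ (-(e * m))) ^ i * (α ^ (e * n)) ^ k := by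
    rw [← zpow_natCast, ← zpow_natCast, ← zpow_mul, ← zpow_mul, ← zpow_add₀ hα]
    congr 1
    ring
  have h₂ : β ^ (e * (b * i - a * k)) = (β ^ (e * b)) ^ i * (β ^ (-(e * a))) ^ k := by
    rw [← zpow_natCast, ← zpow_natCast, ← zpow_mul, ← zpow_mul, ← zpow_add₀ hβ]
    congr 1
    ring
  rw [h₁, h₂]
  simp only [mono, scale]
  ring

theorem mono_scale_left (he : e = a * m - b * n) (hee : e * e = 1) (hα : α ≠ 0) (hβ : β ≠ 0)
    (p : ℂ × ℂ) : mono a b (scale a b m n e α β p) = mono a b p / α := by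
  have h₁ : e * (n * b - m * a) = -1 := by linear_combination e * he - hee
  have h₂ : e * ((b : ℤ) * a - a * b) = 0 := by ring
  rw [mono_scale hα hβ, h₁, h₂, zpow_neg_one, zpow_zero, mul_one, div_eq_mul_inv]

theorem mono_scale_right (he : e = a * m - b * n) (hee : e * e = 1) (hα : α ≠ 0) (hβ : β ≠ 0)
    (p : ℂ × ℂ) : mono n m (scale a b m n e α β p) = mono n m p / β := by
  have h₁ : e * ((n : ℤ) * m - m * n) = 0 := by ring
  have h₂ : e * ((b : ℤ) * n - a * m) = -1 := by linear_combination e * he - hee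
  rw [mono_scale hα hβ, h₁, h₂, zpow_neg_one, zpow_zero, one_mul, div_eq_mul_inv]

theorem scale_scale (p : ℂ × ℂ) : scale a b m n e α' β' (scale a b m n e α β p) =
    scale a b m n e (α * α') (β * β') p := by
  simp only [scale, mul_zpow, Prod.mk.injEq]
  constructor <;> ring

@[simp] theorem scale_one (p : ℂ × ℂ) : scale a b m n e 1 1 p = p := by
  simp [scale]

/-- Unimodularity of the exponent matrix makes the coordinates Laurent monomials in u and w; thus a
point off the axes is determined by its values of u and w, as `scale_div_mono` exploits. -/
theorem mono_zpow_eq_fst (he : e = a * m - b * n) (hee : e * e = 1) {p : ℂ × ℂ}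
    (hp : p ∈ offAxes) : mono a b p ^ (-(e * m)) * mono n m p ^ (e * b) = p.1⁻¹ := by
  have h : -(a * (e * m)) + n * (e * b) = (-1 : ℤ) := by linear_combination e * he - hee
  have h' : -(b * (e * m)) + m * (e * b) = (0 : ℤ) := by ring
  calc mono a b p ^ (-(e * m)) * mono n m p ^ (e * b)
      = p.1 ^ (-(a * (e * m)) + n * (e * b)) * p.2 ^ (-(b * (e * m)) + m * (e * b)) := by
        simp only [mono, mul_zpow, ← zpow_natCast, ← zpow_mul, zpow_add₀ hp.1, zpow_add₀ hp.2,
          mul_neg]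
        ring
    _ = p.1⁻¹ := by rw [h, h', zpow_neg_one, zpow_zero, mul_one]

theorem mono_zpow_eq_snd (he : e = a * m - b * n) (hee : e * e = 1) {p : ℂ × ℂ}
    (hp : p ∈ offAxes) : mono a b p ^ (e * n) * mono n m p ^ (-(e * a)) = p.2⁻¹ := by
  have h : a * (e * n) + -(n * (e * a)) = (0 : ℤ) := by ring
  have h' : b * (e * n) + -(m * (e * a)) = (-1 : ℤ) := by linear_combination e * he - hee
  calc mono a b p ^ (e * n) * mono n m p ^ (-(e * a))
      = p.1 ^ (a * (e * n) + -(n * (e * a))) * p.2 ^ (b * (e * n) + -(m * (e * a))) := by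
        simp only [mono, mul_zpow, ← zpow_natCast, ← zpow_mul, zpow_add₀ hp.1, zpow_add₀ hp.2,
          mul_neg]
        ring
    _ = p.2⁻¹ := by rw [h, h', zpow_neg_one, zpow_zero, one_mul]

theorem scale_div_mono (he : e = a * m - b * n) (hee : e * e = 1) {p q : ℂ × ℂ}
    (hp : p ∈ offAxes) (hq : q ∈ offAxes) :
    scale a b m n e (mono a b p / mono a b q) (mono n m p / mono n m q) p = q := by
  have h₁ : (mono a b p / mono a b q) ^ (-(e * m)) * (mono n m p / mono n m q) ^ (e * b) =
      p.1⁻¹ / q.1⁻¹ := by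
    rw [div_zpow, div_zpow, ← mono_zpow_eq_fst he hee hp, ← mono_zpow_eq_fst he hee hq]
    ring
  have h₂ : (mono a b p / mono a b q) ^ (e * n) * (mono n m p / mono n m q) ^ (-(e * a)) =
      p.2⁻¹ / q.2⁻¹ := by
    rw [div_zpow, div_zpow, ← mono_zpow_eq_snd he hee hp, ← mono_zpow_eq_snd he hee hq]
    ring
  have hp₁ := hp.1
  have hp₂ := hp.2
  rw [scale, h₁, h₂]
  ext
  · simp [mul_inv_cancel_left₀ hp₁]
  · simp [mul_inv_cancel_left₀ hp₂]

theorem scale_mem_offAxes (hα : α ≠ 0) (hβ : β ≠ 0) {p : ℂ × ℂ} (hp : p ∈ offAxes) :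
    scale a b m n e α β p ∈ offAxes :=
  ⟨mul_ne_zero hp.1 (mul_ne_zero (zpow_ne_zero _ hα) (zpow_ne_zero _ hβ)),
    mul_ne_zero hp.2 (mul_ne_zero (zpow_ne_zero _ hα) (zpow_ne_zero _ hβ))⟩

theorem analyticAt_scale {E : Type*} [NormedAddCommGroup E] [NormedSpace ℂ E] {f g : E → ℂ}
    {h : E → ℂ × ℂ} {x : E} (hf : AnalyticAt ℂ f x) (hg : AnalyticAt ℂ g x)
    (hh : AnalyticAt ℂ h x) (hf0 : f x ≠ 0) (hg0 : g x ≠ 0) :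
    AnalyticAt ℂ (fun x => scale a b m n e (f x) (g x) (h x)) x :=
  ((analyticAt_fst.comp hh).mul ((hf.zpow hf0).mul (hg.zpow hg0))).prod
    ((analyticAt_snd.comp hh).mul ((hf.zpow hf0).mul (hg.zpow hg0)))

theorem analyticAt_mono {E : Type*} [NormedAddCommGroup E] [NormedSpace ℂ E]
    {h : E → ℂ × ℂ} {x : E} (hh : AnalyticAt ℂ h x) (i k : ℕ) :
    AnalyticAt ℂ (fun x => mono i k (h x)) x :=
  ((analyticAt_fst.comp hh).pow i).mul ((analyticAt_snd.comp hh).pow k)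

end Scaling

/-! ### The explicit local action of the normal form. -/

section Model

/-- The local flow of the commuting vector fields of the normal form. -/
noncomputable def modelFlow (a b m n : ℕ) (e : ℤ) (j : ℕ) (v : EuclideanSpace ℂ (Fin 2)) (p : ℂ × ℂ) : ℂ × ℂ :=
  scale a b m n e (1 - v 0 * mono a b p) (1 - v 1 * mono n m p ^ j) p

/-- The set where the flow of the normal form is finite. -/
def modelDomain (a b m n : ℕ) (j : ℕ) : Set (EuclideanSpace ℂ (Fin 2) × (ℂ × ℂ)) :=
  {x | 1 - x.1 0 * mono a b x.2 ≠ 0 ∧ 1 - x.1 1 * mono n m x.2 ^ j ≠ 0}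

variable {a b m n : ℕ} {e : ℤ} {j : ℕ} {d : ℂ}

theorem continuous_mono (i k : ℕ) : Continuous (mono i k) := by
  unfold mono
  fun_prop

theorem isOpen_modelDomain : IsOpen (modelDomain a b m n j) := by
  have := continuous_mono a b
  have := continuous_mono n m
  exact (isOpen_ne_fun (by fun_prop) (by fun_prop)).inter
    (isOpen_ne_fun (by fun_prop) (by fun_prop))

theorem analyticAt_modelFlow {x : EuclideanSpace ℂ (Fin 2) × (ℂ × ℂ)}
    (hx : x ∈ modelDomain a b m n j) :
    AnalyticAt ℂ (fun x => modelFlow a b m n e j x.1 x.2) x := by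
  have hc : ∀ i : Fin 2,
      AnalyticAt ℂ (fun x : EuclideanSpace ℂ (Fin 2) × (ℂ × ℂ) => x.1 i) x := fun i =>
    ((EuclideanSpace.proj i : EuclideanSpace ℂ (Fin 2) →L[ℂ] ℂ).analyticAt _).comp analyticAt_fst
  exact analyticAt_scale
    (analyticAt_const.sub ((hc 0).mul (analyticAt_mono analyticAt_snd a b)))
    (analyticAt_const.sub ((hc 1).mul ((analyticAt_mono analyticAt_snd n m).pow j)))
    analyticAt_snd hx.1 hx.2

/-- Scalings compose by multiplying factors, and (1 - h₀u)(1 - g₀u/(1 - h₀u)) = 1 - (g₀ + h₀)u. The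
factor for w works alike if j = 1; if j = 0 it does not depend on the point, and the identity is the
group law for d = 1. -/
theorem modelFlow_add (he : e = a * m - b * n) (hee : e * e = 1)
    (hjd : j = 0 ∧ d = 1 ∨ j = 1 ∧ d = 0) {g h : TimeGroup d} {p : ℂ × ℂ}
    (hh : (h.val, p) ∈ modelDomain a b m n j) :
    modelFlow a b m n e j (g + h).val p =
      modelFlow a b m n e j g.val (modelFlow a b m n e j h.val p) := by
  obtain ⟨h₁, h₂⟩ := hh
  simp only at h₁ h₂
  rw [modelFlow, modelFlow, modelFlow, scale_scale, mono_scale_left he hee h₁ h₂,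
    mono_scale_right he hee h₁ h₂]
  congr 1
  · rw [TimeGroup.val_add_zero]
    field_simp
    ring
  · rw [TimeGroup.val_add_one]
    rcases hjd with ⟨rfl, rfl⟩ | ⟨rfl, rfl⟩
    · ring
    · rw [pow_one] at h₂ ⊢
      field_simp
      ring

/-- The domain of the local action of the normal form on the open set `V`. -/
def modelActionDomain (a b m n : ℕ) (e : ℤ) (j : ℕ) (d : ℂ) (V : Set (ℂ × ℂ)) :
    Set (TimeGroup d × (ℂ × ℂ)) :=
  {x | x.2 ∈ V ∧ (x.1.val, x.2) ∈ modelDomain a b m n j ∧ modelFlow a b m n e j x.1.val x.2 ∈ V}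

theorem continuous_val_prod :
    Continuous fun x : TimeGroup d × (ℂ × ℂ) => (x.1.val, x.2) :=
  (TimeGroup.isOpenEmbedding_val.continuous.comp continuous_fst).prodMk continuous_snd

theorem continuousOn_modelFlow : ContinuousOn
    (fun x : TimeGroup d × (ℂ × ℂ) => modelFlow a b m n e j x.1.val x.2)
    ((fun x => (x.1.val, x.2)) ⁻¹' modelDomain a b m n j) := fun _ hx =>
  (ContinuousAt.comp (f := fun x : TimeGroup d × (ℂ × ℂ) => (x.1.val, x.2))
    (analyticAt_modelFlow (e := e) hx).continuousAt
    continuous_val_prod.continuousAt).continuousWithinAt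

theorem isOpen_modelActionDomain {V : Set (ℂ × ℂ)} (hV : IsOpen V) :
    IsOpen (modelActionDomain a b m n e j d V) := by
  have h := (continuousOn_modelFlow (a := a) (b := b) (m := m) (n := n) (e := e) (j := j)
    (d := d)).isOpen_inter_preimage (isOpen_modelDomain.preimage continuous_val_prod) hV
  exact (hV.preimage continuous_snd).inter h

/-- The group element moving `p` to `q`, for `p` and `q` off the axes. -/
theorem exists_modelFlow_eq (he : e = a * m - b * n) (hee : e * e = 1)
    (hjd : j = 0 ∧ d = 1 ∨ j = 1 ∧ d = 0) :
    ∃ τ : offAxes × offAxes → TimeGroup d, Continuous τ ∧ ∀ p q : offAxes,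
      ((τ (p, q)).val, (p : ℂ × ℂ)) ∈ modelDomain a b m n j ∧
      modelFlow a b m n e j (τ (p, q)).val p = q ∧
      ∀ g : TimeGroup d, modelFlow a b m n e j g.val p = q →
        (g.val, (p : ℂ × ℂ)) ∈ modelDomain a b m n j → g = τ (p, q) := by
  have hu : ∀ p : offAxes, mono a b p ≠ 0 := fun p => mono_ne_zero p.2 a b
  have hw : ∀ p : offAxes, mono n m p ≠ 0 := fun p => mono_ne_zero p.2 n m
  have hα : ∀ p q : offAxes, 1 - (1 / mono a b p - 1 / mono a b q) * mono a b p =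
      mono a b p / mono a b q := fun p q => by
    have := hu p
    have := hu q
    field_simp
    ring
  have hβ : ∀ p q : offAxes, 1 - (1 - mono n m p / mono n m q) / mono n m p ^ j * mono n m p ^ j =
      mono n m p / mono n m q := fun p q => by
    rw [div_mul_cancel₀ _ (pow_ne_zero j (hw p))]
    ring
  have hmem : ∀ p q : offAxes,
      1 - d * ((1 - mono n m p / mono n m q) / mono n m p ^ j) ≠ 0 := by
    intro p q
    rcases hjd with ⟨rfl, rfl⟩ | ⟨rfl, rfl⟩
    · simpa using ⟨hw p, hw q⟩
    · simp
  -- Obtained by solving u(p)/(1 - v₀ u(p)) = u(q) and w(p)/(1 - v₁ w(p)^j) = w(q).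
  let v : offAxes × offAxes → EuclideanSpace ℂ (Fin 2) := fun x =>
    !₂[1 / mono a b x.1 - 1 / mono a b x.2, (1 - mono n m x.1 / mono n m x.2) / mono n m x.1 ^ j]
  have hv : Continuous v := by
    have h₁ : ∀ i k, Continuous fun x : offAxes × offAxes => mono i k x.1 := fun i k =>
      (continuous_mono i k).comp (continuous_subtype_val.comp continuous_fst)
    have h₂ : ∀ i k, Continuous fun x : offAxes × offAxes => mono i k x.2 := fun i k =>
      (continuous_mono i k).comp (continuous_subtype_val.comp continuous_snd)
    refine (PiLp.continuous_toLp 2 _).comp (continuous_pi fun i => ?_)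
    fin_cases i
    · exact (continuous_const.div (h₁ a b) fun x => hu x.1).sub
        (continuous_const.div (h₂ a b) fun x => hu x.2)
    · exact (continuous_const.sub ((h₁ n m).div (h₂ n m) fun x => hw x.2)).div
        ((h₁ n m).pow j) fun x => pow_ne_zero j (hw x.1)
  refine ⟨fun x => ⟨v x, hmem x.1 x.2⟩, hv.subtype_mk _, fun p q => ⟨?_, ?_, ?_⟩⟩
  · refine ⟨?_, ?_⟩
    · change 1 - (1 / mono a b p - 1 / mono a b q) * mono a b p ≠ 0
      rw [hα]
      exact div_ne_zero (hu p) (hu q)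
    · change 1 - (1 - mono n m p / mono n m q) / mono n m p ^ j * mono n m p ^ j ≠ 0
      rw [hβ]
      exact div_ne_zero (hw p) (hw q)
  · change scale a b m n e (1 - (1 / mono a b p - 1 / mono a b q) * mono a b p)
      (1 - (1 - mono n m p / mono n m q) / mono n m p ^ j * mono n m p ^ j) p = q
    rw [hα, hβ, scale_div_mono he hee p.2 q.2]
  · rintro g hg ⟨h₁, h₂⟩
    have e₁ : mono a b p / (1 - g.val 0 * mono a b p) = mono a b q := by
      rw [← hg, modelFlow, mono_scale_left he hee h₁ h₂]
    have e₂ : mono n m p / (1 - g.val 1 * mono n m p ^ j) = mono n m q := by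
      rw [← hg, modelFlow, mono_scale_right he hee h₁ h₂]
    have hup := hu p
    have hwp := hw p
    apply TimeGroup.ext_val
    · change _ = 1 / mono a b p - 1 / mono a b q
      simp only at h₁
      rw [← e₁]
      field_simp
      ring
    · change _ = (1 - mono n m p / mono n m q) / mono n m p ^ j
      simp only at h₂
      rw [← e₂]
      field_simp
      ring

theorem isConnected_modelActionDomain (he : e = a * m - b * n) (hee : e * e = 1)
    (hjd : j = 0 ∧ d = 1 ∨ j = 1 ∧ d = 0) {V : Set (ℂ × ℂ)} (hVo : IsOpen V)
    (hV : IsConnected V) : IsConnected (modelActionDomain a b m n e j d V) := by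
  obtain ⟨τ, hτ, hτ'⟩ := exists_modelFlow_eq (a := a) (b := b) (m := m) (n := n) he hee hjd
  have hW : IsConnected {p : offAxes | (p : ℂ × ℂ) ∈ V} := by
    have h := isConnected_inter_offAxes hVo hV
    rw [inter_comm, ← Subtype.image_preimage_coe] at h
    have hind : Topology.IsInducing ((↑) : offAxes → ℂ × ℂ) := Topology.IsInducing.subtypeVal
    exact ⟨h.nonempty.of_image, hind.isPreconnected_image.mp h.isPreconnected⟩
  -- Off the axes a pair (g, p) is the same as the pair (p, g·p), so this part of the domain is the
  -- continuous image of a product of connected sets.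
  have himg : modelActionDomain a b m n e j d V ∩ {x | x.2 ∈ offAxes} =
      (fun x : offAxes × offAxes => (τ x, (x.1 : ℂ × ℂ))) ''
        ({p : offAxes | (p : ℂ × ℂ) ∈ V} ×ˢ {p : offAxes | (p : ℂ × ℂ) ∈ V}) := by
    ext ⟨g, p⟩
    constructor
    · rintro ⟨⟨hp, hd, hq⟩, hp'⟩
      refine ⟨(⟨p, hp'⟩, ⟨_, scale_mem_offAxes hd.1 hd.2 hp'⟩), ⟨hp, hq⟩, ?_⟩
      exact Prod.ext ((hτ' ⟨p, hp'⟩ ⟨_, scale_mem_offAxes hd.1 hd.2 hp'⟩).2.2 g rfl hd).symm rfl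
    · rintro ⟨⟨p, q⟩, ⟨hp, hq⟩, h⟩
      obtain ⟨rfl, rfl⟩ := Prod.mk.inj h
      obtain ⟨h₁, h₂, -⟩ := hτ' p q
      refine ⟨⟨hp, h₁, ?_⟩, p.2⟩
      simp only
      rw [h₂]
      exact hq
  have hcon : IsConnected (modelActionDomain a b m n e j d V ∩ {x | x.2 ∈ offAxes}) := by
    rw [himg]
    exact (hW.prod hW).image _
      (hτ.prodMk (continuous_subtype_val.comp continuous_fst)).continuousOn
  refine hcon.subset_closure inter_subset_left ?_
  have hdense : Dense {x : TimeGroup d × (ℂ × ℂ) | x.2 ∈ offAxes} :=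
    dense_offAxes.preimage isOpenMap_snd
  exact hdense.open_subset_closure_inter (isOpen_modelActionDomain hVo)

theorem isMaximalLocalAction_model (he : e = a * m - b * n) (hee : e * e = 1)
    (hjd : j = 0 ∧ d = 1 ∨ j = 1 ∧ d = 0) {V : Set (ℂ × ℂ)} (hVo : IsOpen V)
    (hV : IsConnected V) :
    IsMaximalLocalAction (EG := EuclideanSpace ℂ (Fin 2)) V (modelActionDomain a b m n e j d V)
      (fun x => modelFlow a b m n e j x.1.val x.2) := by
  have hzero : ∀ p, modelFlow a b m n e j (0 : TimeGroup d).val p = p := fun p => by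
    simp [modelFlow]
  refine ⟨⟨fun x hx => ⟨mem_univ _, hx.1⟩, isOpen_modelActionDomain hVo,
    isConnected_modelActionDomain he hee hjd hVo hV, ?_, fun x hx => hx.2.2, ?_,
    fun p _ => hzero p, fun g₁ g₂ p h₂ _ _ => modelFlow_add he hee hjd h₂.2.1⟩, ?_⟩
  · exact fun p hp => ⟨hp, by simp [modelDomain], by simpa only [hzero] using hp⟩
  · have h₁ : ContDiffOn ℂ ω
        (fun x : EuclideanSpace ℂ (Fin 2) × (ℂ × ℂ) => modelFlow a b m n e j x.1 x.2)
        (modelDomain a b m n j) := fun x hx =>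
      (analyticAt_modelFlow hx).contDiffAt.contDiffWithinAt
    exact h₁.contMDiffOn.comp (((TimeGroup.contMDiff_val.comp contMDiff_fst).prodMk_space
      contMDiff_snd).contMDiffOn) fun x hx => hx.2.1
  · intro p hp γ g hγ hlim hg K hKV hK
    -- Otherwise a subsequence of the orbit converges to some `q` in `K`. The limiting relations
    -- `hα`, `hβ` show that the flow is still defined at `g`, so `g` lies in the open time domain
    -- and not on its frontier.
    by_contra hne
    obtain ⟨q, hqK, φ, hφ, hq⟩ := hK.tendsto_subseq' (not_eventually.mp hne |>.mono
      fun i hi => not_not.mp hi)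
    have hlim' := (TimeGroup.isOpenEmbedding_val.continuous.tendsto g).comp
      (hlim.comp hφ.tendsto_atTop)
    have hlimc : ∀ i : Fin 2, Tendsto (fun k => (γ (φ k)).val i) atTop (𝓝 (g.val i)) := fun i =>
      ((EuclideanSpace.proj i : EuclideanSpace ℂ (Fin 2) →L[ℂ] ℂ).continuous.tendsto _).comp hlim'
    have hα : mono a b q * (1 - g.val 0 * mono a b p) = mono a b p := by
      refine tendsto_nhds_unique ((((continuous_mono a b).tendsto q).comp hq).mul
        (tendsto_const_nhds.sub ((hlimc 0).mul_const _))) ?_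
      refine tendsto_const_nhds.congr fun k => ?_
      obtain ⟨h₁, h₂⟩ := (hγ (φ k)).2.1
      simp only [Function.comp_apply]
      rw [modelFlow, mono_scale_left he hee h₁ h₂, div_mul_cancel₀ _ h₁]
    have hβ : mono n m q * (1 - g.val 1 * mono n m p ^ j) = mono n m p := by
      refine tendsto_nhds_unique ((((continuous_mono n m).tendsto q).comp hq).mul
        (tendsto_const_nhds.sub ((hlimc 1).mul_const _))) ?_
      refine tendsto_const_nhds.congr fun k => ?_
      obtain ⟨h₁, h₂⟩ := (hγ (φ k)).2.1
      simp only [Function.comp_apply]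
      rw [modelFlow, mono_scale_right he hee h₁ h₂, div_mul_cancel₀ _ h₂]
    have hdom : (g.val, p) ∈ modelDomain a b m n j := by
      constructor
      · intro h0
        simp only at h0
        -- If the factor vanished, `hα` would force u(p) = 0, and the factor would be 1. The same
        -- works for w if j = 1; if j = 0 the factor is nonzero because `g` belongs to the group.
        have hu : mono a b p = 0 := by rw [← hα, h0, mul_zero]
        simp [hu] at h0
      · intro h0
        simp only at h0
        have hw : mono n m p = 0 := by rw [← hβ, h0, mul_zero]
        rcases hjd with ⟨rfl, rfl⟩ | ⟨rfl, rfl⟩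
        · refine g.val_ne ?_
          simpa using h0
        · simp [hw] at h0
    have hcont : ContinuousAt (fun g : TimeGroup d => modelFlow a b m n e j g.val p) g :=
      ContinuousAt.comp (f := fun g : TimeGroup d => (g.val, p))
        (analyticAt_modelFlow (e := e) hdom).continuousAt
        (TimeGroup.isOpenEmbedding_val.continuous.prodMk continuous_const).continuousAt
    have hqeq : modelFlow a b m n e j g.val p = q :=
      tendsto_nhds_unique (hcont.tendsto.comp (hlim.comp hφ.tendsto_atTop)) hq
    have hgmem : g ∈ timeDomain (modelActionDomain a b m n e j d V) p :=
      ⟨hp, hdom, by simpa only [hqeq] using hKV hqK⟩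
    have hopen : IsOpen (timeDomain (modelActionDomain a b m n e j d V) p) :=
      (isOpen_modelActionDomain hVo).preimage (continuous_id.prodMk continuous_const)
    rw [hopen.frontier_eq] at hg
    exact hg.2 hgmem

end Model

/-! ### Logarithmic derivatives. -/

section LogDeriv

/-- `f` has the derivative `f s * l` at `s`. -/
def HasLogDerivAt (f : ℂ → ℂ) (l s : ℂ) : Prop := HasDerivAt f (f s * l) s

variable {f g : ℂ → ℂ} {l l' s : ℂ}

theorem HasLogDerivAt.mul (hf : HasLogDerivAt f l s) (hg : HasLogDerivAt g l' s) :
    HasLogDerivAt (fun t => f t * g t) (l + l') s := by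
  refine (HasDerivAt.mul hf hg).congr_deriv ?_
  ring

theorem HasLogDerivAt.pow (hf : HasLogDerivAt f l s) (k : ℕ) :
    HasLogDerivAt (fun t => f t ^ k) (k * l) s := by
  refine (HasDerivAt.pow hf k).congr_deriv ?_
  rcases k with _ | k
  · simp
  · simp only [Nat.add_sub_cancel, pow_succ]
    ring

theorem HasLogDerivAt.zpow (hf : HasLogDerivAt f l s) (h : f s ≠ 0) (k : ℤ) :
    HasLogDerivAt (fun t => f t ^ k) (k * l) s := by
  refine ((hasDerivAt_zpow k (f s) (Or.inl h)).comp s hf).congr_deriv ?_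
  rw [zpow_sub_one₀ h]
  field_simp

theorem HasDerivAt.hasLogDerivAt {f' : ℂ} (hf : HasDerivAt f f' s) (h : f s ≠ 0) :
    HasLogDerivAt f (f' / f s) s :=
  hf.congr_deriv (by field_simp)

variable {γ : ℂ → ℂ × ℂ} {ξ ζ : ℂ}

/-- Since `HasLogDerivAt` never divides by the function, this computation is valid on the axes too.
-/
theorem hasLogDerivAt_mono (h₁ : HasLogDerivAt (fun t => (γ t).1) ξ s)
    (h₂ : HasLogDerivAt (fun t => (γ t).2) ζ s) (i k : ℕ) :
    HasLogDerivAt (fun t => mono i k (γ t)) (i * ξ + k * ζ) s :=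
  (h₁.pow i).mul (h₂.pow k)

theorem hasDerivAt_scale {a b m n : ℕ} {e : ℤ} {α β : ℂ → ℂ} {q r : ℂ}
    (h₁ : HasLogDerivAt (fun t => (γ t).1) ξ s) (h₂ : HasLogDerivAt (fun t => (γ t).2) ζ s)
    (hα : HasLogDerivAt α q s) (hβ : HasLogDerivAt β r s) (hα0 : α s ≠ 0) (hβ0 : β s ≠ 0) :
    HasDerivAt (fun t => scale a b m n e (α t) (β t) (γ t))
      ((scale a b m n e (α s) (β s) (γ s)).1 * (ξ - e * m * q + e * b * r),
        (scale a b m n e (α s) (β s) (γ s)).2 * (ζ + e * n * q - e * a * r)) s := by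
  refine HasDerivAt.prodMk ?_ ?_
  · refine (h₁.mul ((hα.zpow hα0 _).mul (hβ.zpow hβ0 _))).congr_deriv ?_
    push_cast [scale]
    ring
  · refine (h₂.mul ((hα.zpow hα0 _).mul (hβ.zpow hβ0 _))).congr_deriv ?_
    push_cast [scale]
    ring

theorem hasLogDerivAt_line_fst (p : ℂ × ℂ) (ξ ζ : ℂ) :
    HasLogDerivAt (fun t : ℂ => (p + t • (p.1 * ξ, p.2 * ζ)).1) ξ 0 := by
  have h : HasDerivAt (fun t : ℂ => p.1 + t * (p.1 * ξ)) (1 * (p.1 * ξ)) 0 :=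
    ((hasDerivAt_id (0 : ℂ)).mul_const _).const_add _
  exact h.congr_deriv (by simp)

theorem hasLogDerivAt_line_snd (p : ℂ × ℂ) (ξ ζ : ℂ) :
    HasLogDerivAt (fun t : ℂ => (p + t • (p.1 * ξ, p.2 * ζ)).2) ζ 0 := by
  have h : HasDerivAt (fun t : ℂ => p.2 + t * (p.2 * ζ)) (1 * (p.2 * ζ)) 0 :=
    ((hasDerivAt_id (0 : ℂ)).mul_const _).const_add _
  exact h.congr_deriv (by simp)

theorem fderiv_apply_eq_of_line {E F : Type*} [NormedAddCommGroup E] [NormedSpace ℂ E]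
    [NormedAddCommGroup F] [NormedSpace ℂ F] {f : E → F} {p v : E} {D : F}
    (hf : DifferentiableAt ℂ f p) (h : HasDerivAt (fun t : ℂ => f (p + t • v)) D 0) :
    fderiv ℂ f p v = D :=
  (hf.hasFDerivAt.hasLineDerivAt v).unique h

end LogDeriv

/-! ### The commuting fields of the normal form. -/

section ModelFields

/-- The vector field `x ^ a * y ^ b * (m x ∂x - n y ∂y)`. -/
def fieldU (a b m n : ℕ) (p : ℂ × ℂ) : ℂ × ℂ :=
  (p.1 * (m * mono a b p), p.2 * (-(n * mono a b p)))

/-- The vector field `e * (x ^ n * y ^ m) ^ j * (-b x ∂x + a y ∂y)`. -/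
def fieldW (a b m n : ℕ) (e : ℤ) (j : ℕ) (p : ℂ × ℂ) : ℂ × ℂ :=
  (p.1 * (-(e * b * mono n m p ^ j)), p.2 * (e * a * mono n m p ^ j))

variable {a b m n : ℕ} {e : ℤ} {j : ℕ}

theorem analyticAt_fieldU (p : ℂ × ℂ) : AnalyticAt ℂ (fieldU a b m n) p :=
  have h := analyticAt_mono (x := p) analyticAt_id a b
  (analyticAt_fst.mul (analyticAt_const.mul h)).prod
    (analyticAt_snd.mul (analyticAt_const.mul h).neg)

theorem analyticAt_fieldW (p : ℂ × ℂ) : AnalyticAt ℂ (fieldW a b m n e j) p :=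
  have h := (analyticAt_mono (x := p) analyticAt_id n m).pow j
  (analyticAt_fst.mul (analyticAt_const.mul h).neg).prod
    (analyticAt_snd.mul (analyticAt_const.mul h))

theorem hasLogDerivAt_const_mul {f : ℂ → ℂ} {l s : ℂ} (c : ℂ) (hf : HasLogDerivAt f l s) :
    HasLogDerivAt (fun t => c * f t) l s :=
  (HasDerivAt.const_mul c hf).congr_deriv (by ring)

theorem hasDerivAt_line_mul {f g : ℂ × ℂ → ℂ} {p : ℂ × ℂ} {ξ ζ l l' : ℂ}
    (hf : HasLogDerivAt (fun t => f (p + t • (p.1 * ξ, p.2 * ζ))) l 0)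
    (hg : HasLogDerivAt (fun t => g (p + t • (p.1 * ξ, p.2 * ζ))) l' 0) (c c' : ℂ) :
    HasDerivAt (fun t : ℂ => (fun q : ℂ × ℂ => (q.1 * (c * f q), q.2 * (c' * g q)))
        (p + t • (p.1 * ξ, p.2 * ζ)))
      (p.1 * (c * f p) * (ξ + l), p.2 * (c' * g p) * (ζ + l')) 0 := by
  refine (HasDerivAt.prodMk ((hasLogDerivAt_line_fst p ξ ζ).mul (hasLogDerivAt_const_mul c hf))
    ((hasLogDerivAt_line_snd p ξ ζ).mul (hasLogDerivAt_const_mul c' hg))).congr_deriv ?_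
  simp

/-- The fields are u D and w^j D' with D, D' diagonal linear fields, which commute; moreover D w = 0
and D' u = 0. -/
theorem lieBracket_fieldU_fieldW (p : ℂ × ℂ) :
    VectorField.lieBracket ℂ (fieldU a b m n) (fieldW a b m n e j) p = 0 := by
  have eU : fieldU a b m n = fun q => (q.1 * (m * mono a b q), q.2 * (-n * mono a b q)) := by
    funext q
    simp [fieldU]
  have eW : fieldW a b m n e j = fun q =>
      (q.1 * (-(e * b) * mono n m q ^ j), q.2 * (e * a * mono n m q ^ j)) := by
    funext q
    simp [fieldW]
  have hU := fderiv_apply_eq_of_line (analyticAt_fieldU (a := a) (b := b) (m := m) (n := n)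
    p).differentiableAt (v := fieldW a b m n e j p) (D := _) (by
      rw [eU, eW]
      have hu := hasLogDerivAt_mono
        (hasLogDerivAt_line_fst p (-(e * b) * mono n m p ^ j) (e * a * mono n m p ^ j))
        (hasLogDerivAt_line_snd p (-(e * b) * mono n m p ^ j) (e * a * mono n m p ^ j)) a b
      exact hasDerivAt_line_mul hu hu m (-n))
  have hW := fderiv_apply_eq_of_line (analyticAt_fieldW (a := a) (b := b) (m := m) (n := n) (e := e)
    (j := j) p).differentiableAt (v := fieldU a b m n p) (D := _) (by
      rw [eU, eW]
      have hw := (hasLogDerivAt_mono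
        (hasLogDerivAt_line_fst p (m * mono a b p) (-n * mono a b p))
        (hasLogDerivAt_line_snd p (m * mono a b p) (-n * mono a b p)) n m).pow j
      exact hasDerivAt_line_mul (f := fun q => mono n m q ^ j) (g := fun q => mono n m q ^ j)
        hw hw (-(e * b)) (e * a))
  rw [VectorField.lieBracket, hU, hW]
  ext
  · simp only [Prod.fst_sub, Prod.fst_zero]
    ring
  · simp only [Prod.snd_sub, Prod.snd_zero]
    ring

/-- The derivative at `0` of the flow of the normal form with respect to time. -/
noncomputable def timeDeriv (X Z : ℂ × ℂ) : EuclideanSpace ℂ (Fin 2) →L[ℂ] ℂ × ℂ :=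
  (EuclideanSpace.proj 0 : EuclideanSpace ℂ (Fin 2) →L[ℂ] ℂ).smulRight X +
    (EuclideanSpace.proj 1 : EuclideanSpace ℂ (Fin 2) →L[ℂ] ℂ).smulRight Z

theorem timeDeriv_apply (X Z : ℂ × ℂ) (v : EuclideanSpace ℂ (Fin 2)) :
    timeDeriv X Z v = v 0 • X + v 1 • Z := rfl

/-- The factor `e` appears because the flow in v₀ satisfies du/dv₀ = u², whereas `fieldU` maps u to
e u². -/
theorem hasFDerivAt_modelFlow_zero (p : ℂ × ℂ) :
    HasFDerivAt (fun v => modelFlow a b m n e j v p)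
      (timeDeriv ((e : ℂ) • fieldU a b m n p) (fieldW a b m n e j p)) 0 := by
  have hdom : ((0 : EuclideanSpace ℂ (Fin 2)), p) ∈ modelDomain a b m n j := by
    simp [modelDomain]
  have hd : DifferentiableAt ℂ (fun v => modelFlow a b m n e j v p) 0 :=
    ((analyticAt_modelFlow (e := e) hdom).comp₂ (f := id) (g := fun _ => p) analyticAt_id
      analyticAt_const).differentiableAt
  convert hd.hasFDerivAt using 1
  ext1 v
  rw [timeDeriv_apply]
  symm
  refine fderiv_apply_eq_of_line hd ?_
  have hγ₁ : HasLogDerivAt (fun _ : ℂ => p.1) 0 0 := (hasDerivAt_const _ _).congr_deriv (by simp)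
  have hγ₂ : HasLogDerivAt (fun _ : ℂ => p.2) 0 0 := (hasDerivAt_const _ _).congr_deriv (by simp)
  have hlin : ∀ c d : ℂ, HasLogDerivAt (fun t : ℂ => 1 - t * c * d) (-(c * d)) 0 := fun c d => by
    have : HasDerivAt (fun t : ℂ => 1 - t * c * d) (-(1 * c * d)) 0 :=
      ((((hasDerivAt_id (0 : ℂ)).mul_const c).mul_const d)).const_sub 1
    exact this.congr_deriv (by simp)
  have h := hasDerivAt_scale (a := a) (b := b) (m := m) (n := n) (e := e) (γ := fun _ => p)
    hγ₁ hγ₂ (hlin (v 0) (mono a b p)) (hlin (v 1) (mono n m p ^ j)) (by simp) (by simp)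
  have hfun : (fun t : ℂ => modelFlow a b m n e j (0 + t • v) p) = fun t : ℂ =>
      scale a b m n e (1 - t * v 0 * mono a b p) (1 - t * v 1 * mono n m p ^ j) p := by
    funext t
    simp [modelFlow]
  rw [hfun]
  refine h.congr_deriv ?_
  simp only [zero_mul, sub_zero, scale_one, fieldU, fieldW]
  ext
  · simp
    ring
  · simp
    ring

end ModelFields

/-! ### Effect of the change of coordinates on X and Y. -/

section Straightening

/-- The change of coordinates which takes the pair of vector fields to its normal form. -/
noncomputable def straighten (a b m n : ℕ) (e : ℤ) (A B : ℕ) (η κ : ℂ → ℂ) (p : ℂ × ℂ) : ℂ × ℂ :=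
  scale a b m n e (1 - e * (mono A B p * η (mono n m p))) (κ (mono n m p))⁻¹ p

variable {a b m n A B N j : ℕ} {e : ℤ} {η κ : ℂ → ℂ} {η' κ' : ℂ} {p : ℂ × ℂ}

theorem hasDerivAt_straighten {ξ ζ : ℂ} (hη : HasDerivAt η η' (mono n m p))
    (hκ : HasDerivAt κ κ' (mono n m p)) (hκ0 : κ (mono n m p) ≠ 0)
    (hQ : 1 - e * (mono A B p * η (mono n m p)) ≠ 0) :
    HasDerivAt (fun t : ℂ => straighten a b m n e A B η κ (p + t • (p.1 * ξ, p.2 * ζ)))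
      ((straighten a b m n e A B η κ p).1 * (ξ - e * m *
          (-(e * (mono A B p * (A * ξ + B * ζ) * η (mono n m p) +
            mono A B p * (η' * (mono n m p * (n * ξ + m * ζ))))) /
            (1 - e * (mono A B p * η (mono n m p)))) +
          e * b * (-(κ' * (mono n m p * (n * ξ + m * ζ))) / κ (mono n m p))),
        (straighten a b m n e A B η κ p).2 * (ζ + e * n *
          (-(e * (mono A B p * (A * ξ + B * ζ) * η (mono n m p) +
            mono A B p * (η' * (mono n m p * (n * ξ + m * ζ))))) /
            (1 - e * (mono A B p * η (mono n m p)))) -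
          e * a * (-(κ' * (mono n m p * (n * ξ + m * ζ))) / κ (mono n m p)))) 0 := by
  have h₁ := hasLogDerivAt_line_fst p ξ ζ
  have h₂ := hasLogDerivAt_line_snd p ξ ζ
  have hp : p + (0 : ℂ) • (p.1 * ξ, p.2 * ζ) = p := by simp
  have hw := hasLogDerivAt_mono h₁ h₂ n m
  have hμ := hasLogDerivAt_mono h₁ h₂ A B
  unfold HasLogDerivAt at hw hμ
  simp only [hp] at hw hμ
  have hη₁ := HasDerivAt.comp_of_eq (0 : ℂ) hη hw (by simp)
  have hκ₁ := HasDerivAt.comp_of_eq (0 : ℂ) hκ hw (by simp)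
  have hQ₁ := ((hμ.mul hη₁).const_mul (e : ℂ)).const_sub 1
  have hκ₂ := hκ₁.inv (by simpa only [Function.comp_apply, hp] using hκ0)
  have hκ₀ : (κ ∘ fun t : ℂ => mono n m (p + t • (p.1 * ξ, p.2 * ζ)))⁻¹ 0 ≠ 0 := by
    simpa only [Pi.inv_apply, Function.comp_apply, hp] using inv_ne_zero hκ0
  have h := hasDerivAt_scale (a := a) (b := b) (m := m) (n := n) (e := e) h₁ h₂
    (HasDerivAt.hasLogDerivAt hQ₁ (by simpa only [Function.comp_apply, Pi.mul_apply, hp] using hQ))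
    (HasDerivAt.hasLogDerivAt hκ₂ hκ₀) (by simpa only [Function.comp_apply, Pi.mul_apply, hp] using hQ) hκ₀
  refine h.congr_deriv ?_
  simp only [hp, Function.comp_apply, Pi.mul_apply, Pi.inv_apply]
  have hr : -(κ' * (mono n m p * (n * ξ + m * ζ))) / κ (mono n m p) ^ 2 / (κ (mono n m p))⁻¹ =
      -(κ' * (mono n m p * (n * ξ + m * ζ))) / κ (mono n m p) := by
    field_simp
  rw [hr]
  rfl

/-- The new u satisfies 1/u' = 1/u - e η(w)/w^N. Since X kills w, both X(1/u') = -e and X w' = 0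
hold, as for the normal form. -/
theorem hasDerivAt_straighten_fieldU (he : e = a * m - b * n) (hee : e * e = 1)
    (hA : A + n * N = a) (hB : B + m * N = b) (hη : HasDerivAt η η' (mono n m p))
    (hκ : HasDerivAt κ κ' (mono n m p)) (hκ0 : κ (mono n m p) ≠ 0)
    (hQ : 1 - e * (mono A B p * η (mono n m p)) ≠ 0) :
    HasDerivAt (fun t : ℂ => straighten a b m n e A B η κ (p + t • fieldU a b m n p))
      (fieldU a b m n (straighten a b m n e A B η κ p)) 0 := by
  refine (hasDerivAt_straighten hη hκ hκ0 hQ).congr_deriv ?_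
  have heC : (e : ℂ) = a * m - b * n := by exact_mod_cast congrArg (Int.cast (R := ℂ)) he
  have heeC : (e : ℂ) * e = 1 := by exact_mod_cast congrArg (Int.cast (R := ℂ)) hee
  have hAC : (A : ℂ) + n * N = a := by exact_mod_cast congrArg (Nat.cast (R := ℂ)) hA
  have hBC : (B : ℂ) + m * N = b := by exact_mod_cast congrArg (Nat.cast (R := ℂ)) hB
  have hu : mono a b (straighten a b m n e A B η κ p) =
      mono a b p / (1 - e * (mono A B p * η (mono n m p))) :=
    mono_scale_left he hee hQ (inv_ne_zero hκ0) p
  have hl : (A : ℂ) * m - B * n = e := by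
    rw [heC, ← hAC, ← hBC]
    ring
  have key : -((e : ℂ) * (mono A B p * (A * (m * mono a b p) + B * (-(n * mono a b p))) *
      η (mono n m p) + mono A B p * (η' * (mono n m p *
        (n * (m * mono a b p) + m * (-(n * mono a b p))))))) =
      -(mono a b p * (mono A B p * η (mono n m p))) := by
    linear_combination (-(e : ℂ) * mono a b p * mono A B p * η (mono n m p)) * hl -
      mono a b p * mono A B p * η (mono n m p) * heeC
  simp only [fieldU]
  have hR : mono a b p = mono a b p / (1 - e * (mono A B p * η (mono n m p))) *
      (1 - e * (mono A B p * η (mono n m p))) := (div_mul_cancel₀ _ hQ).symm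
  rw [key, hu, neg_div, mul_div_right_comm]
  generalize mono a b p / (1 - e * (mono A B p * η (mono n m p))) = u at hR ⊢
  generalize straighten a b m n e A B η κ p = q
  ext
  · linear_combination q.1 * m * hR
  · linear_combination -q.2 * n * hR

/-- With w' = w κ(w), `hgκ` says Y w' = m l e w'^(j+1), and `hgη` says Y(1/u') = -e c. These are the
values taken by the field on the right. -/
theorem hasDerivAt_straighten_transverse (he : e = a * m - b * n) (hee : e * e = 1) (hm : 0 < m)
    (hA : A + n * N = a) (hB : B + m * N = b) {F φ g c l : ℂ}
    (hη : HasDerivAt η η' (mono n m p))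
    (hκ : HasDerivAt κ κ' (mono n m p)) (hκ0 : κ (mono n m p) ≠ 0)
    (hQ : 1 - e * (mono A B p * η (mono n m p)) ≠ 0)
    (hF : F = mono A B p * φ)
    (hgκ : g * (mono n m p * κ' + κ (mono n m p)) =
      l * mono n m p ^ j * κ (mono n m p) ^ (j + 1))
    (hgη : m ^ 2 * (g * (mono n m p * η' - N * η (mono n m p))) =
      e * (m * c * mono n m p ^ N - g * φ)) :
    HasDerivAt (fun t : ℂ => straighten a b m n e A B η κ (p + t •
        (p.1 * (g * (-(b * m) + F)), p.2 * (g * (a * m - n / m * F)))))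
      (c • fieldU a b m n (straighten a b m n e A B η κ p) +
        (m * l * e) • fieldW a b m n e j (straighten a b m n e A B η κ p)) 0 := by
  refine (hasDerivAt_straighten hη hκ hκ0 hQ).congr_deriv ?_
  have heC : (e : ℂ) = a * m - b * n := by exact_mod_cast congrArg (Int.cast (R := ℂ)) he
  have heeC : (e : ℂ) * e = 1 := by exact_mod_cast congrArg (Int.cast (R := ℂ)) hee
  have hAC : (A : ℂ) + n * N = a := by exact_mod_cast congrArg (Nat.cast (R := ℂ)) hA
  have hBC : (B : ℂ) + m * N = b := by exact_mod_cast congrArg (Nat.cast (R := ℂ)) hB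
  have hmC : (m : ℂ) ≠ 0 := by exact_mod_cast hm.ne'
  have hu : mono a b (straighten a b m n e A B η κ p) =
      mono a b p / (1 - e * (mono A B p * η (mono n m p))) :=
    mono_scale_left he hee hQ (inv_ne_zero hκ0) p
  have hw : mono n m (straighten a b m n e A B η κ p) = mono n m p * κ (mono n m p) := by
    rw [straighten, mono_scale_right he hee hQ (inv_ne_zero hκ0), div_inv_eq_mul]
  have hl : (A : ℂ) * m - B * n = e := by
    rw [heC, ← hAC, ← hBC]
    ring
  have huμ : mono a b p = mono A B p * mono n m p ^ N := by
    rw [← hA, ← hB]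
    simp only [mono]
    ring
  -- `hr` and `hlin` are the logarithmic derivatives along Y of w and of x^A y^B; the terms in `F`
  -- cancel in the first.
  have hr : (n : ℂ) * (g * (-(b * m) + F)) + m * (g * (a * m - n / m * F)) = g * m * e := by
    rw [heC]
    field_simp
    ring
  have hlin : (A : ℂ) * (g * (-(b * m) + F)) + B * (g * (a * m - n / m * F)) =
      g * (e * F / m - m * N * e) := by
    rw [← hAC, ← hBC, ← hl]
    field_simp
    ring
  have hk : m * (mono A B p * (g * (mono n m p * η' - N * η (mono n m p)))) =
      e * (c * (mono A B p * mono n m p ^ N) - g * F / m) := by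
    apply mul_left_cancel₀ hmC
    rw [hF]
    have hmm : (m : ℂ) * (g * (mono A B p * φ) / m) = g * (mono A B p * φ) :=
      mul_div_cancel₀ _ hmC
    linear_combination mono A B p * hgη + (e : ℂ) * hmm
  have key : -((e : ℂ) * (mono A B p * (A * (g * (-(b * m) + F)) + B * (g * (a * m - n / m * F))) *
      η (mono n m p) + mono A B p * (η' * (mono n m p *
        (n * (g * (-(b * m) + F)) + m * (g * (a * m - n / m * F))))))) =
      -e * c * mono a b p + e * g * F / m * (1 - e * (mono A B p * η (mono n m p))) := by
    rw [hr, hlin, huμ]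
    linear_combination -hk + (mono A B p * m * N * g * η (mono n m p) -
      mono A B p * η' * mono n m p * g * m) * heeC
  have hs : -(κ' * (mono n m p * (g * m * e))) / κ (mono n m p) =
      -(m * e) * (l * (mono n m p * κ (mono n m p)) ^ j - g) := by
    rw [div_eq_iff hκ0, mul_pow]
    rw [pow_succ] at hgκ
    linear_combination -(m : ℂ) * e * hgκ
  simp only [fieldU, fieldW]
  rw [key, hr, hs, hu, hw]
  have hdiv : (-e * c * mono a b p + e * g * F / m * (1 - e * (mono A B p * η (mono n m p)))) /
      (1 - e * (mono A B p * η (mono n m p))) =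
      -e * c * (mono a b p / (1 - e * (mono A B p * η (mono n m p)))) + e * (g * (F / m)) := by
    rw [add_div, mul_div_cancel_right₀ _ hQ]
    ring
  have hFm : (m : ℂ) * (F / m) = F := mul_div_cancel₀ _ hmC
  rw [hdiv]
  generalize mono a b p / (1 - e * (mono A B p * η (mono n m p))) = u
  generalize (mono n m p * κ (mono n m p)) ^ j = W
  generalize straighten a b m n e A B η κ p = q
  ext
  · simp only [Prod.fst_add, Prod.smul_fst, smul_eq_mul]
    linear_combination (q.1 * (m * c * u - m * g * (F / m) - b * m * (l * W - g))) * heeC -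
      q.1 * g * hFm + q.1 * m * l * b * W * heeC
  · simp only [Prod.snd_add, Prod.smul_snd, smul_eq_mul]
    linear_combination (q.2 * (-n * c * u + n * g * (F / m) + a * m * (l * W - g))) * heeC -
      q.2 * m * l * a * W * heeC

end Straightening

/-! ### One-variable normal forms and the Euler equation. -/

section OneVariable

theorem exists_primitive {K : ℂ → ℂ} (hK : AnalyticAt ℂ K 0) :
    ∃ H : ℂ → ℂ, AnalyticAt ℂ H 0 ∧ ∀ᶠ z in 𝓝 0, HasDerivAt H (K z) z := by
  obtain ⟨r, hr, hK'⟩ := Metric.eventually_nhds_iff_ball.mp hK.eventually_analyticAt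
  obtain ⟨H, hH⟩ := DifferentiableOn.isExactOn_ball (f := K) (c := 0) (r := r)
    fun z hz => (hK' z hz).differentiableAt.differentiableWithinAt
  have hball : Metric.ball (0 : ℂ) r ∈ 𝓝 0 := Metric.ball_mem_nhds 0 hr
  refine ⟨H, ?_, ?_⟩
  · exact DifferentiableOn.analyticAt (fun z hz =>
      (hH z hz).differentiableAt.differentiableWithinAt) hball
  · filter_upwards [hball] with z hz using hH z hz

theorem eq_add_mul_dslope (K : ℂ → ℂ) (z : ℂ) : K z = K 0 + z * dslope K 0 z := by
  have := sub_smul_dslope K 0 z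
  rw [sub_zero, smul_eq_mul] at this
  rw [this]
  ring

/-- The equation `z η' - N η = K` can be solved up to the term of degree `N` of `K`. -/
theorem exists_euler_solution (N : ℕ) {K : ℂ → ℂ} {p : FormalMultilinearSeries ℂ ℂ ℂ}
    (hK : HasFPowerSeriesAt K p 0) : ∃ η : ℂ → ℂ, AnalyticAt ℂ η 0 ∧
      ∀ᶠ z in 𝓝 0, z * deriv η z - N * η z = K z - p.coeff N * z ^ N := by
  induction N generalizing K p with
  | zero =>
    obtain ⟨H, hH, hH'⟩ := exists_primitive hK.has_fpower_series_dslope_fslope.analyticAt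
    refine ⟨H, hH, ?_⟩
    filter_upwards [hH'] with z hz
    have h0 : p.coeff 0 = K 0 := hK.coeff_zero 1
    rw [hz.deriv, h0]
    simp only [Nat.cast_zero, pow_zero]
    linear_combination -eq_add_mul_dslope K z
  | succ N ih =>
    obtain ⟨η, hη, hη'⟩ := ih hK.has_fpower_series_dslope_fslope
    -- Writing K = K(0) + z K₁, the substitution η = const + z η₁ turns the equation of index N + 1
    -- into that of index N for K₁.
    refine ⟨fun z => -K 0 / (N + 1) + z * η z, analyticAt_const.add (analyticAt_id.mul hη), ?_⟩
    filter_upwards [hη', hη.eventually_analyticAt] with z hz haz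
    have hd : HasDerivAt (fun z => -K 0 / (N + 1) + z * η z) (1 * η z + z * deriv η z) z :=
      ((hasDerivAt_id z).mul haz.differentiableAt.hasDerivAt).const_add _
    rw [hd.deriv]
    rw [FormalMultilinearSeries.coeff_fslope] at hz
    have hN : -K 0 / (N + 1 : ℂ) * (N + 1) = -K 0 :=
      div_mul_cancel₀ _ (by exact_mod_cast N.succ_ne_zero)
    push_cast
    linear_combination z * hz - eq_add_mul_dslope K z - hN

/-- Linearization of `z * g z * ∂z` if `g 0 ≠ 0`. -/
theorem exists_linearization {g : ℂ → ℂ} (hg : AnalyticAt ℂ g 0) (hg0 : g 0 ≠ 0) :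
    ∃ κ : ℂ → ℂ, AnalyticAt ℂ κ 0 ∧ κ 0 ≠ 0 ∧
      ∀ᶠ z in 𝓝 0, g z * (z * deriv κ z + κ z) = g 0 * κ z := by
  obtain ⟨p, hp⟩ : AnalyticAt ℂ (fun z => g 0 / g z) 0 := analyticAt_const.div hg hg0
  -- With κ = exp ξ the equation reads 1 + z ξ' = g(0)/g(z), so ξ' is the slope of g(0)/g at 0.
  obtain ⟨ξ, hξ, hξ'⟩ := exists_primitive hp.has_fpower_series_dslope_fslope.analyticAt
  refine ⟨fun z => Complex.exp (ξ z), hξ.cexp, Complex.exp_ne_zero _, ?_⟩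
  filter_upwards [hξ', hg.continuousAt.eventually_ne hg0] with z hz hgz
  rw [hz.cexp.deriv]
  have h := eq_add_mul_dslope (fun z => g 0 / g z) z
  simp only [div_self hg0] at h
  have h' : g 0 / g z * g z = g 0 := div_mul_cancel₀ _ hgz
  linear_combination Complex.exp (ξ z) * h' - Complex.exp (ξ z) * g z * h

/-- A vector field `z * g z * ∂z` with a double zero and vanishing residue is conjugate to a
multiple of `z ^ 2 * ∂z`. -/
theorem exists_parabolic_normal_form {g : ℂ → ℂ} (hg : AnalyticAt ℂ g 0) (hg0 : g 0 = 0)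
    (hg1 : deriv g 0 ≠ 0) (hg2 : iteratedDeriv 2 g 0 = 0) :
    ∃ κ : ℂ → ℂ, AnalyticAt ℂ κ 0 ∧ κ 0 ≠ 0 ∧
      ∀ᶠ z in 𝓝 0, g z * (z * deriv κ z + κ z) = deriv g 0 * z * κ z ^ 2 := by
  have hp := hg.hasFPowerSeriesAt.has_fpower_series_dslope_fslope
  have hd1 : deriv (dslope g 0) 0 = 0 := by
    rw [hp.deriv]
    change FormalMultilinearSeries.coeff _ 1 = 0
    rw [FormalMultilinearSeries.coeff_fslope, FormalMultilinearSeries.coeff_ofScalars, hg2,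
      zero_div]
  have hd0 : dslope g 0 0 = deriv g 0 := dslope_same g 0
  have hd0' : dslope g 0 0 ≠ 0 := by rwa [hd0]
  have hG : AnalyticAt ℂ (fun z => deriv g 0 / dslope g 0 z) 0 :=
    analyticAt_const.div hp.analyticAt hd0'
  have hG1 : deriv (fun z => deriv g 0 / dslope g 0 z) 0 = 0 := by
    have h := (hasDerivAt_const (0 : ℂ) (deriv g 0)).div
      hp.analyticAt.differentiableAt.hasDerivAt hd0'
    rw [hd1] at h
    exact h.deriv.trans (by simp)
  obtain ⟨q, hq⟩ := hG
  -- Put G = g'(0) z/g(z). With 1/(zκ) = 1/z - R the equation becomes R' = (G - 1)/z². This is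
  -- holomorphic because G(0) = 1 and G'(0) = 0, the latter coming from g''(0) = 0.
  obtain ⟨R, hR, hR'⟩ := exists_primitive
    hq.has_fpower_series_dslope_fslope.has_fpower_series_dslope_fslope.analyticAt
  have h1R : AnalyticAt ℂ (fun z => 1 - z * R z) 0 :=
    analyticAt_const.sub (analyticAt_id.mul hR)
  have h1R0 : (1 : ℂ) - 0 * R 0 ≠ 0 := by simp
  refine ⟨fun z => (1 - z * R z)⁻¹, h1R.inv h1R0, inv_ne_zero h1R0, ?_⟩
  filter_upwards [hR', hp.analyticAt.continuousAt.eventually_ne hd0',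
    h1R.continuousAt.eventually_ne h1R0] with z hz hdz h1z
  have hd : HasDerivAt (fun z => (1 - z * R z)⁻¹) (-(-(1 * R z + z *
      dslope (dslope (fun z => deriv g 0 / dslope g 0 z) 0) 0 z)) / (1 - z * R z) ^ 2) z :=
    (((hasDerivAt_id z).mul hz).const_sub 1).inv h1z
  rw [hd.deriv]
  have h₁ := eq_add_mul_dslope (fun z => deriv g 0 / dslope g 0 z) z
  have h₂ := eq_add_mul_dslope (dslope (fun z => deriv g 0 / dslope g 0 z) 0) z
  have h₃ := eq_add_mul_dslope g z
  rw [dslope_same, hG1, zero_add] at h₂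
  simp only [hd0, div_self hg1] at h₁
  rw [h₂] at h₁
  rw [hg0, zero_add] at h₃
  have h' : deriv g 0 / dslope g 0 z * dslope g 0 z = deriv g 0 := div_mul_cancel₀ _ hdz
  generalize dslope (dslope (fun z => deriv g 0 / dslope g 0 z) 0) 0 z = r at *
  rw [h₃]
  field_simp
  rw [div_eq_iff hdz] at h₁
  linear_combination -z * h₁

/-- A Laurent series is the quotient of a power series by a power of the variable. -/
theorem HasLaurentSeriesAtZero.exists_powerSeries {f : ℂ → ℂ} {c : ℤ → ℂ}
    (hf : HasLaurentSeriesAtZero f c) :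
    ∃ (N : ℕ) (φ : ℂ → ℂ) (p : FormalMultilinearSeries ℂ ℂ ℂ), HasFPowerSeriesAt φ p 0 ∧
      p.coeff N = c 0 ∧ (N = 0 ∨ φ 0 ≠ 0) ∧ ∀ᶠ z in 𝓝 0, z ≠ 0 → z ^ N * f z = φ z := by
  classical
  obtain ⟨⟨N₀, hN₀⟩, hsum⟩ := hf
  have hex : ∃ N : ℕ, ∀ k : ℤ, k < -N → c k = 0 :=
    ⟨N₀.natAbs, fun k hk => hN₀ k (by omega)⟩
  -- The least such `N` is the pole order, or 0 if there is no pole; minimality gives the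
  -- nonvanishing of φ(0) when N > 0.
  obtain ⟨N, hN, hmin⟩ : ∃ N : ℕ, (∀ k : ℤ, k < -N → c k = 0) ∧ (N = 0 ∨ c (-N) ≠ 0) := by
    refine ⟨Nat.find hex, Nat.find_spec hex, ?_⟩
    rcases h : Nat.find hex with _ | N
    · exact Or.inl rfl
    · right
      have hlt := Nat.find_min hex (m := N) (by omega)
      push Not at hlt
      obtain ⟨k, hk, hck⟩ := hlt
      have hk' : ¬ k < -((N + 1 : ℕ) : ℤ) := fun hlt' =>
        hck (Nat.find_spec hex k (by rw [h]; exact hlt'))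
      have : k = -((N + 1 : ℕ) : ℤ) := by
        push_cast at hk' ⊢
        omega
      rwa [← this]
  refine ⟨N, fun z => if z = 0 then c (-N) else z ^ N * f z,
    FormalMultilinearSeries.ofScalars ℂ fun i : ℕ => c (i - N), ?_, ?_, ?_, ?_⟩
  · rw [hasFPowerSeriesAt_iff]
    rw [eventually_nhdsWithin_iff] at hsum
    filter_upwards [hsum] with z hz
    simp only [FormalMultilinearSeries.coeff_ofScalars, zero_add, smul_eq_mul]
    by_cases h0 : z = 0
    · subst h0
      simp only [if_true]
      have h := hasSum_single (f := fun i : ℕ => (0 : ℂ) ^ i * c (i - N)) 0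
        fun i hi => by simp [hi]
      simpa using h
    · rw [if_neg h0]
      have hinj : Function.Injective fun i : ℕ => (i : ℤ) - N := fun i k hik => by
        simpa using hik
      have h := (hinj.hasSum_iff (f := fun k : ℤ => z ^ N * (c k * z ^ k)) (a := z ^ N * f z)
        fun k hk => by
          rw [hN k, zero_mul, mul_zero]
          by_contra hlt
          exact hk ⟨(k + N).toNat, by simp only; omega⟩).mpr ((hz h0).mul_left _)
      refine h.congr_fun ?_
      intro i
      simp only [Function.comp_apply, zpow_sub₀ h0, zpow_natCast]
      field_simp
  · simp
  · simpa using hmin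
  · exact Eventually.of_forall fun z hz => by simp [hz]

end OneVariable

/-! ### From the normal form to univalence. -/

section NormalForm

theorem indicator_mem_holVectorFields {E : Type*} [NormedAddCommGroup E] [NormedSpace ℂ E]
    {U : TopologicalSpace.Opens E} {V : E → E} (hV : AnalyticOnNhd ℂ V U) :
    (U : Set E).indicator V ∈ holVectorFields U := by
  refine ⟨fun x hx => (hV x hx).congr ?_, fun x hx => indicator_of_notMem hx V⟩
  filter_upwards [U.isOpen.mem_nhds hx] with y hy using (indicator_of_mem hy V).symm

variable {E : Type*} [NormedAddCommGroup E] [NormedSpace ℂ E]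

theorem fderiv_symm_comp_fderiv (T : OpenPartialHomeomorph E E) {p : E} (hp : p ∈ T.source)
    (hT : AnalyticAt ℂ T p) (hT' : AnalyticAt ℂ T.symm (T p)) :
    (fderiv ℂ T.symm (T p)).comp (fderiv ℂ T p) = ContinuousLinearMap.id ℂ E := by
  have h₁ := hT'.differentiableAt.hasFDerivAt.comp p hT.differentiableAt.hasFDerivAt
  refine h₁.unique ((hasFDerivAt_id p).congr_of_eventuallyEq ?_)
  filter_upwards [T.open_source.mem_nhds hp] with q hq using T.left_inv hq

theorem fderiv_comp_fderiv_symm (T : OpenPartialHomeomorph E E) {p : E} (hp : p ∈ T.source)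
    (hT : AnalyticAt ℂ T p) (hT' : AnalyticAt ℂ T.symm (T p)) :
    (fderiv ℂ T p).comp (fderiv ℂ T.symm (T p)) = ContinuousLinearMap.id ℂ E := by
  have h := fderiv_symm_comp_fderiv T.symm (p := T p) (T.map_source hp) hT'
    (by rwa [T.symm_symm, T.left_inv hp])
  rwa [T.left_inv hp, T.symm_symm] at h

/-- Near each point the fields are pullbacks of `X'` and `Z'`, and pullback commutes with brackets.
-/
theorem lieBracket_eq_zero_of_related [CompleteSpace E]
    (T : OpenPartialHomeomorph E E) {U : Set E} (hU : IsOpen U) (hUT : U ⊆ T.source) (hT : ∀ p ∈ U, AnalyticAt ℂ T p)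
    (hT' : ∀ p ∈ U, AnalyticAt ℂ T.symm (T p)) {X Z X' Z' : E → E}
    (hX : ∀ p ∈ U, fderiv ℂ T p (X p) = X' (T p)) (hZ : ∀ p ∈ U, fderiv ℂ T p (Z p) = Z' (T p))
    (hX' : ∀ q, DifferentiableAt ℂ X' q) (hZ' : ∀ q, DifferentiableAt ℂ Z' q)
    (h : ∀ q, VectorField.lieBracket ℂ X' Z' q = 0) {p : E} (hp : p ∈ U) :
    VectorField.lieBracket ℂ X Z p = 0 := by
  have key : ∀ {W W' : E → E}, (∀ p ∈ U, fderiv ℂ T p (W p) = W' (T p)) →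
      W =ᶠ[𝓝 p] VectorField.pullback ℂ T W' := by
    intro W W' hW
    filter_upwards [hU.mem_nhds hp] with q hq
    have hinv : (fderiv ℂ T q).inverse = fderiv ℂ T.symm (T q) :=
      ContinuousLinearMap.inverse_eq
        (fderiv_comp_fderiv_symm T (hUT hq) (hT q hq) (hT' q hq))
        (fderiv_symm_comp_fderiv T (hUT hq) (hT q hq) (hT' q hq))
    rw [VectorField.pullback, hinv, ← hW q hq]
    exact (DFunLike.congr_fun
      (fderiv_symm_comp_fderiv T (hUT hq) (hT q hq) (hT' q hq)) (W q)).symm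
  rw [(key hX).lieBracket_vectorField_eq (key hZ),
    ← VectorField.pullback_lieBracket (n := ω) le_top (hT p hp).contDiffAt (hX' _) (hZ' _),
    VectorField.pullback, h, map_zero]

variable {a b m n j : ℕ} {e : ℤ} {d : ℂ}

theorem eq_zero_of_fieldU_add_fieldW (he : e = a * m - b * n) (hee : e * e = 1) {q : ℂ × ℂ}
    (hq : q ∈ offAxes) {s t : ℂ} (h : s • fieldU a b m n q + t • fieldW a b m n e j q = 0) :
    s = 0 ∧ t = 0 := by
  have heC : (e : ℂ) = a * m - b * n := by exact_mod_cast congrArg (Int.cast (R := ℂ)) he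
  have heeC : (e : ℂ) * e = 1 := by exact_mod_cast congrArg (Int.cast (R := ℂ)) hee
  have he0 : (e : ℂ) ≠ 0 := left_ne_zero_of_mul_eq_one heeC
  have h₁ := congrArg Prod.fst h
  have h₂ := congrArg Prod.snd h
  simp only [fieldU, fieldW, Prod.fst_add, Prod.smul_fst, Prod.snd_add, Prod.smul_snd,
    smul_eq_mul, Prod.fst_zero, Prod.snd_zero] at h₁ h₂
  have h₁' : s * (m * mono a b q) - t * (e * b * mono n m q ^ j) = 0 := by
    apply mul_left_cancel₀ hq.1
    linear_combination h₁
  have h₂' : -(s * (n * mono a b q)) + t * (e * a * mono n m q ^ j) = 0 := by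
    apply mul_left_cancel₀ hq.2
    linear_combination h₂
  have hu := mono_ne_zero hq a b
  have hw := pow_ne_zero j (mono_ne_zero hq n m)
  constructor
  · apply mul_right_cancel₀ (mul_ne_zero hu he0)
    linear_combination a * h₁' + b * h₂' + s * mono a b q * heC
  · apply mul_right_cancel₀ hw
    linear_combination n * h₁' + m * h₂' + t * mono n m q ^ j * e * heC -
      t * mono n m q ^ j * heeC

/-- X and Z = (Y - cX)/l are carried to the two commuting model fields, so the generated algebra is
abelian with basis eX, Z. The model action on the connected open set T(U), pulled back by T,
integrates it. -/
theorem isUnivalent_of_normal_form (he : e = a * m - b * n) (hee : e * e = 1)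
    (hjd : j = 0 ∧ d = 1 ∨ j = 1 ∧ d = 0) {U : TopologicalSpace.Opens (ℂ × ℂ)}
    (hU : IsConnected (U : Set (ℂ × ℂ))) (T : OpenPartialHomeomorph (ℂ × ℂ) (ℂ × ℂ))
    (hUT : (U : Set (ℂ × ℂ)) ⊆ T.source) (hT : ∀ p ∈ U, AnalyticAt ℂ T p)
    (hT' : ∀ p ∈ U, AnalyticAt ℂ T.symm (T p)) (X Y : holVectorFields U) {c l : ℂ} (hl : l ≠ 0)
    (hX : ∀ p ∈ U, fderiv ℂ T p ((X : ℂ × ℂ → ℂ × ℂ) p) = fieldU a b m n (T p))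
    (hY : ∀ p ∈ U, fderiv ℂ T p ((Y : ℂ × ℂ → ℂ × ℂ) p) =
      c • fieldU a b m n (T p) + l • fieldW a b m n e j (T p)) :
    IsUnivalent (LieSubalgebra.lieSpan ℂ (holVectorFields U) {X, Y}) := by
  have heeC : (e : ℂ) * e = 1 := by exact_mod_cast congrArg (Int.cast (R := ℂ)) hee
  have hVo : IsOpen (T '' U) := T.isOpen_image_of_subset_source U.isOpen hUT
  have hV : IsConnected (T '' U) :=
    hU.image _ fun p hp => (hT p hp).continuousAt.continuousWithinAt
  obtain ⟨Z, hZdef⟩ : ∃ Z : holVectorFields U, Z = l⁻¹ • (Y - c • X) := ⟨_, rfl⟩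
  have hYZ : Y = c • X + l • Z := by
    rw [hZdef, smul_inv_smul₀ hl]
    abel
  have hZ : ∀ p ∈ U, fderiv ℂ T p ((Z : ℂ × ℂ → ℂ × ℂ) p) = fieldW a b m n e j (T p) := by
    intro p hp
    have hZp : (Z : ℂ × ℂ → ℂ × ℂ) p =
        l⁻¹ • ((Y : ℂ × ℂ → ℂ × ℂ) p - c • (X : ℂ × ℂ → ℂ × ℂ) p) := by
      rw [hZdef]
      rfl
    rw [hZp, map_smul, map_sub, map_smul, hX p hp, hY p hp, add_sub_cancel_left,
      inv_smul_smul₀ hl]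
  have hXZ : ⁅X, Z⁆ = 0 := vf_ext fun p hp =>
    lieBracket_eq_zero_of_related T U.isOpen hUT hT hT' hX hZ
      (fun q => (analyticAt_fieldU q).differentiableAt)
      (fun q => (analyticAt_fieldW q).differentiableAt) lieBracket_fieldU_fieldW hp
  let L : EuclideanSpace ℂ (Fin 2) →ₗ[ℂ] holVectorFields U :=
    (EuclideanSpace.proj 0 : EuclideanSpace ℂ (Fin 2) →L[ℂ] ℂ).toLinearMap.smulRight
        ((e : ℂ) • X) +
      (EuclideanSpace.proj 1 : EuclideanSpace ℂ (Fin 2) →L[ℂ] ℂ).toLinearMap.smulRight Z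
  have hL : ∀ v, L v = v 0 • (e : ℂ) • X + v 1 • Z := fun v => rfl
  have hLp : ∀ v p, (L v : ℂ × ℂ → ℂ × ℂ) p =
      v 0 • (e : ℂ) • (X : ℂ × ℂ → ℂ × ℂ) p + v 1 • (Z : ℂ × ℂ → ℂ × ℂ) p := fun v p => rfl
  have hTL : ∀ v, ∀ p ∈ U, fderiv ℂ T p ((L v : ℂ × ℂ → ℂ × ℂ) p) =
      v 0 • (e : ℂ) • fieldU a b m n (T p) + v 1 • fieldW a b m n e j (T p) := fun v p hp => by
    rw [hLp, map_add, map_smul, map_smul, map_smul, hX p hp, hZ p hp]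
  have hinj : Function.Injective L := by
    rw [← LinearMap.ker_eq_bot, LinearMap.ker_eq_bot']
    intro v hv
    obtain ⟨q, ⟨p, hp, rfl⟩, hq⟩ := dense_offAxes.inter_open_nonempty _ hVo hV.nonempty
    have h := hTL v p hp
    rw [hv] at h
    have h0 : ((0 : holVectorFields U) : ℂ × ℂ → ℂ × ℂ) p = 0 := rfl
    rw [h0, map_zero, smul_smul] at h
    obtain ⟨h₁, h₂⟩ := eq_zero_of_fieldU_add_fieldW he hee hq h.symm
    ext i
    fin_cases i
    · exact (mul_eq_zero.mp h₁).resolve_right (left_ne_zero_of_mul_eq_one heeC)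
    · exact h₂
  have hXmem : X ∈ LinearMap.range L := ⟨!₂[(e : ℂ), 0], by
    rw [hL]
    simp [smul_smul, heeC]⟩
  have hZmem : Z ∈ LinearMap.range L := ⟨!₂[0, 1], by
    rw [hL]
    simp⟩
  have hrange : (LieSubalgebra.lieSpan ℂ (holVectorFields U) {X, Y}).toSubmodule =
      LinearMap.range L := by
    apply le_antisymm
    · let K : LieSubalgebra ℂ (holVectorFields U) :=
        { LinearMap.range L with
          lie_mem' := by
            rintro _ _ ⟨v, rfl⟩ ⟨v', rfl⟩
            have hZX : ⁅Z, X⁆ = 0 := by rw [← lie_skew, hXZ, neg_zero]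
            have h0 : ⁅L v, L v'⁆ = 0 := by
              simp only [hL, add_lie, lie_add, smul_lie, lie_smul, lie_self, hXZ, hZX, smul_zero,
                add_zero]
            rw [h0]
            exact (LinearMap.range L).zero_mem }
      have hle : LieSubalgebra.lieSpan ℂ (holVectorFields U) {X, Y} ≤ K := by
        rw [LieSubalgebra.lieSpan_le]
        rintro V (rfl | rfl)
        · exact hXmem
        · rw [hYZ]
          exact (LinearMap.range L).add_mem ((LinearMap.range L).smul_mem _ hXmem)
            ((LinearMap.range L).smul_mem _ hZmem)
      exact hle
    · rintro _ ⟨v, rfl⟩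
      have h₁ : X ∈ LieSubalgebra.lieSpan ℂ (holVectorFields U) {X, Y} :=
        LieSubalgebra.subset_lieSpan (by simp)
      have h₂ : Y ∈ LieSubalgebra.lieSpan ℂ (holVectorFields U) {X, Y} :=
        LieSubalgebra.subset_lieSpan (by simp)
      have h₃ : Z ∈ LieSubalgebra.lieSpan ℂ (holVectorFields U) {X, Y} := by
        rw [hZdef]
        exact Submodule.smul_mem _ _ (sub_mem h₂ (Submodule.smul_mem _ _ h₁))
      rw [hL]
      exact add_mem (Submodule.smul_mem _ _ (Submodule.smul_mem _ _ h₁))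
        (Submodule.smul_mem _ _ h₃)
  have haction := IsMaximalLocalAction.transport (EG := EuclideanSpace ℂ (Fin 2)) T U.isOpen hUT
    (fun p hp => (hT p hp).contDiffAt.contDiffWithinAt)
    (by
      rintro _ ⟨p, hp, rfl⟩
      exact (hT' p hp).contDiffAt.contDiffWithinAt)
    (isMaximalLocalAction_model he hee hjd hVo hV)
  refine ⟨2, TimeGroup d, inferInstance, inferInstance, inferInstance, inferInstance,
    inferInstance, inferInstance, _, _, haction,
    (LinearEquiv.ofInjective L hinj).trans (LinearEquiv.ofEq _ _ hrange.symm), ?_⟩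
  intro v p hp
  have hflow0 : modelFlow a b m n e j 0 (T p) = T p := by simp [modelFlow]
  have hderiv : HasFDerivAt (fun v => T.symm (modelFlow a b m n e j v (T p)))
      ((fderiv ℂ T.symm (T p)).comp (timeDeriv ((e : ℂ) • fieldU a b m n (T p))
        (fieldW a b m n e j (T p)))) (0 : TimeGroup d).val :=
    HasFDerivAt.comp (g := T.symm) (f := fun v => modelFlow a b m n e j v (T p)) _
      (by
        rw [TimeGroup.val_zero, hflow0]
        exact (hT' p hp).differentiableAt.hasFDerivAt)
      (hasFDerivAt_modelFlow_zero (T p))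
  have hm := (TimeGroup.hasMFDerivAt_comp_val hderiv).mfderiv
  have hval : ∀ v : EuclideanSpace ℂ (Fin 2), fderiv ℂ T.symm (T p)
      (timeDeriv ((e : ℂ) • fieldU a b m n (T p)) (fieldW a b m n e j (T p)) v) =
        (L v : ℂ × ℂ → ℂ × ℂ) p := fun v => by
    rw [timeDeriv_apply, ← hTL v p hp]
    exact DFunLike.congr_fun (fderiv_symm_comp_fderiv T (hUT hp) (hT p hp) (hT' p hp)) _
  exact (DFunLike.congr_fun hm v).trans (hval v)

end NormalForm

/-! ### Reduction of the given pair to normal form. -/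

section Reduction

/-- If g(0) ≠ 0, division by g leaves an Euler equation with right-hand side (e/m²)(m c z^N/g - φ);
its coefficient of z^N vanishes for m c = g(0) φ_N. If g(0) = 0, then c = 0 is taken and φ_N = 0 is
what is needed. -/
theorem exists_normalizing_functions {g φ : ℂ → ℂ} {p : FormalMultilinearSeries ℂ ℂ ℂ} {m N : ℕ}
    {e : ℤ} (hm : 0 < m) (hg : AnalyticAt ℂ g 0) (hφ : HasFPowerSeriesAt φ p 0)
    (hcond : g 0 ≠ 0 ∨
      (g 0 = 0 ∧ iteratedDeriv 2 g 0 = 0 ∧ p.coeff N = 0 ∧ deriv g 0 ≠ 0)) :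
    ∃ (j : ℕ) (d l c : ℂ) (η κ : ℂ → ℂ), (j = 0 ∧ d = 1 ∨ j = 1 ∧ d = 0) ∧ l ≠ 0 ∧
      AnalyticAt ℂ η 0 ∧ AnalyticAt ℂ κ 0 ∧ κ 0 ≠ 0 ∧ ∀ᶠ z in 𝓝 0,
        g z * (z * deriv κ z + κ z) = l * z ^ j * κ z ^ (j + 1) ∧
        m ^ 2 * (g z * (z * deriv η z - N * η z)) = e * (m * c * z ^ N - g z * φ z) := by
  have hmC : (m : ℂ) ≠ 0 := by exact_mod_cast hm.ne'
  obtain ⟨η, hη, hη'⟩ := exists_euler_solution N hφ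
  rcases hcond with hg0 | ⟨hg0, hg2, hp, hg1⟩
  · obtain ⟨κ, hκ, hκ0, hκ'⟩ := exists_linearization hg hg0
    obtain ⟨q, hq⟩ : AnalyticAt ℂ (fun z => (g z)⁻¹) 0 := hg.inv hg0
    have hq0 : q.coeff 0 = (g 0)⁻¹ := hq.coeff_zero 1
    obtain ⟨H, hH, hH'⟩ := exists_euler_solution 0 hq
    -- As z H' = 1/g - 1/g(0), the function z^N H accounts for z^N/g, and the earlier η for φ; the
    -- two leftover multiples of z^N cancel.
    refine ⟨0, 1, g 0, g 0 * p.coeff N / m,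
      fun z => e / m ^ 2 * (g 0 * p.coeff N * (z ^ N * H z) - η z), κ, Or.inl ⟨rfl, rfl⟩, hg0,
      analyticAt_const.mul ((analyticAt_const.mul ((analyticAt_id.pow N).mul hH)).sub hη), hκ, hκ0,
      ?_⟩
    filter_upwards [hη', hκ', hH', hη.eventually_analyticAt, hH.eventually_analyticAt,
      hg.continuousAt.eventually_ne hg0] with z hηz hκz hHz aη aH hgz
    refine ⟨by rw [hκz]; ring, ?_⟩
    have hzN : z * (N * z ^ (N - 1)) = N * z ^ N := by
      rcases N with _ | N
      · simp
      · rw [Nat.add_sub_cancel, pow_succ]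
        ring
    have hd := ((((hasDerivAt_pow N z).mul aH.differentiableAt.hasDerivAt).const_mul
      (g 0 * p.coeff N)).sub aη.differentiableAt.hasDerivAt).const_mul (e / m ^ 2 : ℂ)
    have hm2 : (m : ℂ) ^ 2 * (e / m ^ 2) = e := mul_div_cancel₀ _ (pow_ne_zero 2 hmC)
    have hmm : (m : ℂ) * (g 0 * p.coeff N / m) = g 0 * p.coeff N := mul_div_cancel₀ _ hmC
    have hgg : g z * (g z)⁻¹ = 1 := mul_inv_cancel₀ hgz
    have hgg0 : g 0 * (g 0)⁻¹ = 1 := mul_inv_cancel₀ hg0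
    refine Eq.trans (congrArg (fun D => (m : ℂ) ^ 2 * (g z * (z * D - _))) hd.deriv) ?_
    rw [hq0] at hHz
    simp only [Nat.cast_zero, zero_mul, pow_zero, mul_one, sub_zero] at hHz
    linear_combination g z * (z * (g 0 * p.coeff N * (N * z ^ (N - 1) * H z + z ^ N * deriv H z) -
        deriv η z) - N * (g 0 * p.coeff N * (z ^ N * H z) - η z)) * hm2 +
      e * g z * (g 0 * p.coeff N * H z * hzN + g 0 * p.coeff N * z ^ N * hHz - hηz) +
      e * g 0 * p.coeff N * z ^ N * hgg - e * g z * p.coeff N * z ^ N * hgg0 - e * z ^ N * hmm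
  · obtain ⟨κ, hκ, hκ0, hκ'⟩ := exists_parabolic_normal_form hg hg0 hg1 hg2
    refine ⟨1, 0, deriv g 0, 0, fun z => -(e / m ^ 2) * η z, κ, Or.inr ⟨rfl, rfl⟩, hg1,
      analyticAt_const.mul hη, hκ, hκ0, ?_⟩
    filter_upwards [hη', hκ', hη.eventually_analyticAt] with z hηz hκz aη
    refine ⟨by rw [hκz]; ring, ?_⟩
    rw [(aη.differentiableAt.hasDerivAt.const_mul (-(e / m ^ 2 : ℂ))).deriv]
    rw [hp] at hηz
    have hm2 : (m : ℂ) ^ 2 * (e / m ^ 2) = e := mul_div_cancel₀ _ (pow_ne_zero 2 hmC)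
    linear_combination -e * g z * hηz - g z * (z * deriv η z - N * η z) * hm2

theorem mono_zero {i k : ℕ} (h : i ≠ 0 ∨ k ≠ 0) : mono i k 0 = 0 := by
  rcases h with h | h <;> simp [mono, h]

/-- If nN > a, cancelling x^a and setting x = 0 gives y^b φ(0) = 0 for small y ≠ 0. -/
theorem mul_le_of_mono_mul_eq {a b m n N : ℕ} (hn : 0 < n) {F : ℂ × ℂ → ℂ} {φ : ℂ → ℂ}
    (hF : AnalyticAt ℂ F 0) (hφ : AnalyticAt ℂ φ 0) (hφ0 : φ 0 ≠ 0)
    (h : ∀ᶠ p in 𝓝 (0 : ℂ × ℂ), p.1 ≠ 0 → p.2 ≠ 0 →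
      mono n m p ^ N * F p = mono a b p * φ (mono n m p)) : n * N ≤ a := by
  by_contra hlt
  push Not at hlt
  have hφw : AnalyticAt ℂ (fun p => φ (mono n m p)) 0 :=
    AnalyticAt.fun_comp (by rwa [mono_zero (Or.inl hn.ne')]) (analyticAt_mono analyticAt_id n m)
  have h₁ : AnalyticAt ℂ (fun p : ℂ × ℂ => p.1 ^ (n * N - a) * p.2 ^ (m * N) * F p) 0 :=
    ((analyticAt_fst.pow _).mul (analyticAt_snd.pow _)).mul hF
  have h₂ : AnalyticAt ℂ (fun p : ℂ × ℂ => p.2 ^ b * φ (mono n m p)) 0 :=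
    (analyticAt_snd.pow _).mul hφw
  have heq := eventuallyEq_of_offAxes (h₁.eventually_analyticAt.mono fun _ hp => hp.continuousAt)
    (h₂.eventually_analyticAt.mono fun _ hp => hp.continuousAt) (by
      filter_upwards [h] with p hp hp₁ hp₂
      apply mul_left_cancel₀ (pow_ne_zero a hp₁)
      have hpow : p.1 ^ (n * N) = p.1 ^ a * p.1 ^ (n * N - a) := by
        rw [← pow_add, Nat.add_sub_cancel' hlt.le]
      have hw : mono n m p ^ N = p.1 ^ (n * N) * p.2 ^ (m * N) := by
        rw [mono, mul_pow, pow_mul, pow_mul]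
      have := hp hp₁ hp₂
      rw [hw, hpow] at this
      simp only [mono] at this ⊢
      linear_combination this)
  have hy : Tendsto (fun y : ℂ => ((0 : ℂ), y)) (𝓝[≠] 0) (𝓝 0) :=
    (Continuous.tendsto' (f := fun y : ℂ => ((0 : ℂ), y)) (by fun_prop) 0 0 rfl).mono_left nhdsWithin_le_nhds
  obtain ⟨y, hy₁, hy₂⟩ := ((hy.eventually heq).and self_mem_nhdsWithin).exists
  simp only [mono, zero_pow hn.ne', zero_pow (Nat.sub_ne_zero_of_lt hlt), zero_mul] at hy₁
  exact mul_ne_zero (pow_ne_zero b hy₂) hφ0 hy₁.symm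

theorem mul_le_of_mono_mul_eq' {a b m n N : ℕ} (hm : 0 < m) {F : ℂ × ℂ → ℂ} {φ : ℂ → ℂ}
    (hF : AnalyticAt ℂ F 0) (hφ : AnalyticAt ℂ φ 0) (hφ0 : φ 0 ≠ 0)
    (h : ∀ᶠ p in 𝓝 (0 : ℂ × ℂ), p.1 ≠ 0 → p.2 ≠ 0 →
      mono n m p ^ N * F p = mono a b p * φ (mono n m p)) : m * N ≤ b := by
  have hswap : ∀ (i k : ℕ) (p : ℂ × ℂ), mono i k p.swap = mono k i p := fun i k p => by
    simp only [mono, Prod.fst_swap, Prod.snd_swap, mul_comm]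
  refine mul_le_of_mono_mul_eq (a := b) (b := a) (m := n) (n := m) (F := F ∘ Prod.swap) (φ := φ) hm
    (AnalyticAt.comp (by simpa using hF) (analyticAt_snd.prod analyticAt_fst)) hφ hφ0 ?_
  have ht : Tendsto (Prod.swap : ℂ × ℂ → ℂ × ℂ) (𝓝 0) (𝓝 0) := continuous_swap.tendsto' _ _ rfl
  filter_upwards [ht.eventually h] with p hp h₁ h₂
  have := hp h₂ h₁
  rwa [hswap, hswap] at this

/-- The map is (x r₁, y r₂) with r₁(0), r₂(0) ≠ 0, so its derivative at 0 is diagonal and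
invertible. -/
theorem hasFDerivAt_straighten_zero {a b m n A B : ℕ} {e : ℤ} {η κ : ℂ → ℂ}
    (hAB : A ≠ 0 ∨ B ≠ 0) (hn : 0 < n) (hη : AnalyticAt ℂ η 0) (hκ : AnalyticAt ℂ κ 0)
    (hκ0 : κ 0 ≠ 0) :
    AnalyticAt ℂ (straighten a b m n e A B η κ) 0 ∧ ∃ T' : (ℂ × ℂ) ≃L[ℂ] (ℂ × ℂ),
      HasFDerivAt (straighten a b m n e A B η κ) (T' : ℂ × ℂ →L[ℂ] ℂ × ℂ) 0 := by
  have hw0 : mono n m 0 = 0 := mono_zero (Or.inl hn.ne')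
  have hηw : AnalyticAt ℂ (fun p => η (mono n m p)) 0 :=
    AnalyticAt.fun_comp (by rwa [hw0]) (analyticAt_mono analyticAt_id n m)
  have hκw : AnalyticAt ℂ (fun p => (κ (mono n m p))⁻¹) 0 :=
    AnalyticAt.fun_inv (f := fun p => κ (mono n m p))
      (AnalyticAt.fun_comp (by rwa [hw0]) (analyticAt_mono analyticAt_id n m)) (by rwa [hw0])
  have hQ : AnalyticAt ℂ (fun p => 1 - e * (mono A B p * η (mono n m p))) 0 :=
    analyticAt_const.sub (analyticAt_const.mul ((analyticAt_mono analyticAt_id A B).mul hηw))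
  have hQ0 : 1 - e * (mono A B 0 * η (mono n m 0)) ≠ 0 := by simp [mono_zero hAB]
  have hκw0 : (κ (mono n m 0))⁻¹ ≠ 0 := inv_ne_zero (by rwa [hw0])
  refine ⟨analyticAt_scale hQ hκw analyticAt_id hQ0 hκw0, ?_⟩
  have hdiag : ∀ s t : ℤ, ∃ u : ℂˣ, ∃ r : ℂ × ℂ → ℂ, AnalyticAt ℂ r 0 ∧ r 0 = u ∧
      ∀ p, r p = (1 - e * (mono A B p * η (mono n m p))) ^ s * (κ (mono n m p))⁻¹ ^ t :=
    fun s t => ⟨Units.mk0 _ (mul_ne_zero (zpow_ne_zero s hQ0) (zpow_ne_zero t hκw0)), _,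
      (hQ.zpow hQ0).mul (hκw.zpow hκw0), rfl, fun _ => rfl⟩
  obtain ⟨u₁, r₁, hr₁, hu₁, hrs₁⟩ := hdiag (-(e * m)) (e * b)
  obtain ⟨u₂, r₂, hr₂, hu₂, hrs₂⟩ := hdiag (e * n) (-(e * a))
  refine ⟨(ContinuousLinearEquiv.unitsEquivAut ℂ u₁).prodCongr
    (ContinuousLinearEquiv.unitsEquivAut ℂ u₂), ?_⟩
  have h₁ := (hasFDerivAt_fst (𝕜 := ℂ) (p := (0 : ℂ × ℂ))).mul hr₁.differentiableAt.hasFDerivAt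
  have h₂ := (hasFDerivAt_snd (𝕜 := ℂ) (p := (0 : ℂ × ℂ))).mul hr₂.differentiableAt.hasFDerivAt
  have h := h₁.prodMk h₂
  have hfun : straighten a b m n e A B η κ = fun p => (p.1 * r₁ p, p.2 * r₂ p) := by
    funext p
    rw [hrs₁, hrs₂]
    rfl
  rw [hfun]
  refine h.congr_fderiv ?_
  ext <;> simp [hu₁, hu₂]

end Reduction

end UnivalentPair

/-! ### The main theorem. -/

open UnivalentPair Filter in
theorem mainTheorem4
    (a b m n : ℕ) (ha : 0 < a) (hb : 0 < b) (hm : 0 < m) (hn : 0 < n)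
    (hdet : (a : ℤ) * m - b * n = 1 ∨ (a : ℤ) * m - b * n = -1)
    -- `g` is holomorphic, and `f` is meromorphic with Laurent coefficients `c`, near `0 ∈ ℂ`
    (g : ℂ → ℂ) (hg : AnalyticAt ℂ g 0)
    (f : ℂ → ℂ) (c : ℤ → ℂ) (hf : UnivalentPair.HasLaurentSeriesAtZero f c)
    -- the function `x ^ a * y ^ b * f (x ^ n * y ^ m)` is holomorphic near the origin of `ℂ²`,
    -- i.e. it has a holomorphic extension `F`, and has order at least `1` there
    (F : ℂ × ℂ → ℂ) (hF : AnalyticAt ℂ F 0) (hF0 : F 0 = 0)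
    (hFf : ∀ᶠ p in 𝓝 (0 : ℂ × ℂ), p.1 ≠ 0 → p.2 ≠ 0 →
      F p = p.1 ^ a * p.2 ^ b * f (p.1 ^ n * p.2 ^ m))
    (hcond : g 0 ≠ 0 ∨
      (g 0 = 0 ∧ iteratedDeriv 2 g 0 = 0 ∧ c 0 = 0 ∧ deriv g 0 ≠ 0)) :
    ∃ U₀ : TopologicalSpace.Opens (ℂ × ℂ), (0 : ℂ × ℂ) ∈ U₀ ∧
      ∀ U : TopologicalSpace.Opens (ℂ × ℂ), (0 : ℂ × ℂ) ∈ U → IsConnected (U : Set (ℂ × ℂ)) →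
        U ≤ U₀ →
        ∃ X Y : UnivalentPair.holVectorFields U,
          (∀ p ∈ U, (X : ℂ × ℂ → ℂ × ℂ) p =
            (p.1 ^ a * p.2 ^ b) • ((m : ℂ) * p.1, -((n : ℂ) * p.2))) ∧
          (∀ p ∈ U, (Y : ℂ × ℂ → ℂ × ℂ) p =
            g (p.1 ^ n * p.2 ^ m) •
              (p.1 * (-((b : ℂ) * m) + F p), p.2 * ((a : ℂ) * m - (n : ℂ) / m * F p))) ∧
          UnivalentPair.IsUnivalent
            (LieSubalgebra.lieSpan ℂ (UnivalentPair.holVectorFields U) {X, Y}) := by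
  obtain ⟨e, he⟩ : ∃ e : ℤ, e = a * m - b * n := ⟨_, rfl⟩
  have hee : e * e = 1 := by
    rcases hdet with h | h <;> rw [he, h] <;> norm_num
  have heC : (e : ℂ) * e = 1 := by exact_mod_cast congrArg (Int.cast (R := ℂ)) hee
  obtain ⟨N, φ, P, hφ, hPN, hN, hfφ⟩ := hf.exists_powerSeries
  have hw0 : mono n m 0 = 0 := mono_zero (Or.inl hn.ne')
  have hwt : Tendsto (mono n m) (𝓝 0) (𝓝 0) := by
    simpa only [hw0] using (continuous_mono n m).tendsto 0
  have hFφ : ∀ᶠ p in 𝓝 (0 : ℂ × ℂ), p.1 ≠ 0 → p.2 ≠ 0 →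
      mono n m p ^ N * F p = mono a b p * φ (mono n m p) := by
    filter_upwards [hFf, hwt.eventually hfφ] with p hp hφp h₁ h₂
    rw [← hφp (mono_ne_zero ⟨h₁, h₂⟩ n m), hp h₁ h₂]
    simp only [mono]
    ring
  have hNa : n * N ≤ a := by
    rcases hN with rfl | hN
    · simp
    · exact mul_le_of_mono_mul_eq hn hF hφ.analyticAt hN hFφ
  have hNb : m * N ≤ b := by
    rcases hN with rfl | hN
    · simp
    · exact mul_le_of_mono_mul_eq' hm hF hφ.analyticAt hN hFφ
  obtain ⟨A, hA⟩ : ∃ A, A + n * N = a := ⟨a - n * N, Nat.sub_add_cancel hNa⟩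
  obtain ⟨B, hB⟩ : ∃ B, B + m * N = b := ⟨b - m * N, Nat.sub_add_cancel hNb⟩
  -- If A = B = 0, then (a, b) = N (n, m) would make the determinant e zero.
  have hAB : A ≠ 0 ∨ B ≠ 0 := by
    by_contra h
    push Not at h
    obtain ⟨rfl, rfl⟩ := h
    have : e = 0 := by
      rw [he, ← hA, ← hB]
      push_cast
      ring
    simp [this] at hee
  have hφw : AnalyticAt ℂ (fun p => mono A B p * φ (mono n m p)) 0 :=
    (analyticAt_mono analyticAt_id A B).mul
      (AnalyticAt.fun_comp (by rw [hw0]; exact hφ.analyticAt) (analyticAt_mono analyticAt_id n m))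
  -- F = x^A y^B φ(w) on a full neighborhood of 0, axes included, by density and continuity.
  have hFeq := eventuallyEq_of_offAxes
    (hF.eventually_analyticAt.mono fun _ hp => hp.continuousAt)
    (hφw.eventually_analyticAt.mono fun _ hp => hp.continuousAt) (by
      filter_upwards [hFφ] with p hp h₁ h₂
      apply mul_left_cancel₀ (pow_ne_zero N (mono_ne_zero ⟨h₁, h₂⟩ n m))
      rw [hp h₁ h₂, ← hA, ← hB]
      simp only [mono]
      ring)
  obtain ⟨j, d, l, C, η, κ, hjd, hl, hη, hκ, hκ0, hz⟩ :=
    exists_normalizing_functions (N := N) (e := e) hm hg hφ (by rwa [hPN])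
  obtain ⟨hθ, T', hT'⟩ := hasFDerivAt_straighten_zero (a := a) (b := b) (m := m) (e := e) hAB hn hη
    hκ hκ0
  obtain ⟨T, hTdef⟩ : ∃ T, T = hθ.contDiffAt.toOpenPartialHomeomorph _ hT'
    (n := ω) (by simp) := ⟨_, rfl⟩
  have hTθ : (T : ℂ × ℂ → ℂ × ℂ) = straighten a b m n e A B η κ := by
    rw [hTdef]
    rfl
  have hT0 : (0 : ℂ × ℂ) ∈ T.source := by
    rw [hTdef]
    exact ContDiffAt.mem_toOpenPartialHomeomorph_source _ _ _
  have hsymm : AnalyticAt ℂ T.symm (T 0) := by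
    refine ContDiffAt.analyticAt (T.contDiffAt_symm (f₀' := T') (T.map_source hT0) ?_ ?_)
    · rwa [T.left_inv hT0, hTθ]
    · rw [T.left_inv hT0, hTθ]
      exact hθ.contDiffAt
  have hQ0 : AnalyticAt ℂ (fun p => 1 - e * (mono A B p * η (mono n m p))) 0 :=
    analyticAt_const.sub (analyticAt_const.mul ((analyticAt_mono analyticAt_id A B).mul
      (AnalyticAt.fun_comp (by rwa [hw0]) (analyticAt_mono analyticAt_id n m))))
  have hTc : ContinuousAt T 0 := by
    rw [hTθ]
    exact hθ.continuousAt
  have hTs : ∀ᶠ p in 𝓝 (0 : ℂ × ℂ), p ∈ T.source := T.open_source.mem_nhds hT0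
  have hQne := hQ0.continuousAt.eventually_ne (y := 0) (by simp [mono_zero hAB])
  have hηκ := hwt.eventually (hη.eventually_analyticAt.and
    (hκ.eventually_analyticAt.and (hκ.continuousAt.eventually_ne hκ0)))
  -- All the germ identities and regularity conditions hold at every point of one open set, so any
  -- smaller connected `U` inherits them.
  obtain ⟨U₀, hU₀, hU₀o, hU₀0⟩ := eventually_nhds_iff.mp
    ((hTs.and (hθ.eventually_analyticAt.and (hTc.eventually hsymm.eventually_analyticAt))).and
      ((hF.eventually_analyticAt.and (hwt.eventually hg.eventually_analyticAt)).and
        ((hFeq.and (hwt.eventually hz)).and (hηκ.and hQne))))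
  refine ⟨⟨U₀, hU₀o⟩, hU₀0, fun U _ hU hUU₀ => ?_⟩
  have hXa : AnalyticOnNhd ℂ (fieldU a b m n) U := fun p _ => analyticAt_fieldU p
  have hYa : AnalyticOnNhd ℂ (fun p : ℂ × ℂ => (p.1 * (g (mono n m p) * (-((b : ℂ) * m) + F p)),
      p.2 * (g (mono n m p) * ((a : ℂ) * m - (n : ℂ) / m * F p)))) U := fun p hp => by
    obtain ⟨-, ⟨hFp, hgp⟩, -⟩ := hU₀ p (hUU₀ hp)
    have hgw : AnalyticAt ℂ (fun p => g (mono n m p)) p :=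
      AnalyticAt.fun_comp hgp (analyticAt_mono analyticAt_id n m)
    exact (analyticAt_fst.mul (hgw.mul (analyticAt_const.add hFp))).prod
      (analyticAt_snd.mul (hgw.mul (analyticAt_const.sub (analyticAt_const.mul hFp))))
  refine ⟨⟨_, indicator_mem_holVectorFields hXa⟩, ⟨_, indicator_mem_holVectorFields hYa⟩,
    fun p hp => ?_, fun p hp => ?_, ?_⟩
  · refine (Set.indicator_of_mem hp _).trans ?_
    ext
    · simp only [fieldU, mono, Prod.smul_fst, smul_eq_mul]
      ring
    · simp only [fieldU, mono, Prod.smul_snd, smul_eq_mul]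
      ring
  · refine (Set.indicator_of_mem (s := (U : Set (ℂ × ℂ))) hp (fun p : ℂ × ℂ =>
      (p.1 * (g (mono n m p) * (-((b : ℂ) * m) + F p)),
        p.2 * (g (mono n m p) * ((a : ℂ) * m - (n : ℂ) / m * F p))))).trans ?_
    ext
    · simp only [mono, Prod.smul_fst, smul_eq_mul]
      ring
    · simp only [mono, Prod.smul_snd, smul_eq_mul]
      ring
  · have hme : (m : ℂ) * l * e ≠ 0 :=
      mul_ne_zero (mul_ne_zero (by exact_mod_cast hm.ne') hl) (left_ne_zero_of_mul_eq_one heC)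
    refine isUnivalent_of_normal_form (c := C) he hee hjd hU T (fun p hp => (hU₀ p (hUU₀ hp)).1.1)
      (fun p hp => by rw [hTθ]; exact (hU₀ p (hUU₀ hp)).1.2.1)
      (fun p hp => (hU₀ p (hUU₀ hp)).1.2.2) _ _ hme ?_ ?_
    · intro p hp
      obtain ⟨⟨-, hθp, -⟩, -, -, ⟨hηp, hκp, hκp0⟩, hQp⟩ := hU₀ p (hUU₀ hp)
      rw [hTθ]
      simp only [Set.indicator_of_mem (SetLike.mem_coe.mpr hp)]
      exact fderiv_apply_eq_of_line hθp.differentiableAt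
        (hasDerivAt_straighten_fieldU he hee hA hB hηp.differentiableAt.hasDerivAt
          hκp.differentiableAt.hasDerivAt hκp0 hQp)
    · intro p hp
      obtain ⟨⟨-, hθp, -⟩, -, ⟨hFp, hκz, hηz⟩, ⟨hηp, hκp, hκp0⟩, hQp⟩ := hU₀ p (hUU₀ hp)
      rw [hTθ]
      simp only [Set.indicator_of_mem (SetLike.mem_coe.mpr hp)]
      exact fderiv_apply_eq_of_line hθp.differentiableAt
        (hasDerivAt_straighten_transverse he hee hm hA hB hηp.differentiableAt.hasDerivAt
          hκp.differentiableAt.hasDerivAt hκp0 hQp hFp hκz hηz)
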